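/- Let $m,s\ge 0$ be integers, $d=m+s$, and let $T>0$ be such that $2^{\nu}T$ is an integer for some integer $\nu\ge 0$. Let $\sigma:[0,T]\times\mathbb R^d\to\mathbb R^{d\times d}$ take invertible values, let $\mu:[0,T]\times\mathbb R^d\to\mathbb R^d$, and suppose that $\sigma$, $\sigma^{-1}$ (the pointwise matrix inverse) and $\mu$ are $C^1_b$, i.e. continuously differentiable in $(t,z)$ and bounded together with their first derivatives. Let $y:[0,T]\to\mathbb R^s$ be $C^1$, and let $\varphi:\mathbb R^m\to\mathbb R$ satisfy $\lim_{|x|\to\infty}\varphi(x)=\infty$. Write $[x;y]\in\mathbb R^d$ for the vector obtained by stacking $x\in\mathbb R^m$ above $y\in\mathbb R^s$, and $|\cdot|$ for the Euclidean norm. For $n\ge\nu$ put $h=2^{-n}$ and $N=2^nT$. For a discrete path $x=(x_{jh})_{0\le j\le N}$ in $\mathbb R^m$ set $z_{jh}=[x_{jh};y_{jh}]$ and $$\lambda_n(x|y)=-\tfrac12\sum_{j=0}^{N-1}h\,\Bigl|\sigma(jh,z_{jh})^{-1}\Bigl(\frac{z_{jh+h}-z_{jh}}{h}-\mu(jh,z_{jh})\Bigr)\Bigr|^2-\varphi(x_0).$$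 For a $C^1$ path $x:[0,T]\to\mathbb R^m$ set $z_t=[x_t;y_t]$ and $$\Lambda(x|y)=-\tfrac12\int_0^T\bigl|\sigma(t,z_t)^{-1}\bigl(\dot z_t-\mu(t,z_t)\bigr)\bigr|^2\,dt-\varphi(x_0).$$ Then $$\lim_{n\to\infty}\ \inf_x\{-\lambda_n(x|y)\}=\inf_x\{-\Lambda(x|y)\},$$ where the infimum on the left is over all discrete paths, the one on the right is over all $C^1$ paths, and the values are taken in $[-\infty,\infty]$. Suppose in addition that $\varphi$ is lower semicontinuous (for instance continuous), that $\Lambda(\cdot|y)$ has a unique maximizer $x^*$ among the $C^1$ paths on $[0,T]$, and that for each $n\ge\nu$ the discrete path $x_n$ is a maximizer of $\lambda_n(\cdot|y)$. Then $x_n\to x^*$ uniformly: the piecewise linear interpolations of the $x_n$ converge to $x^*$ uniformly on $[0,T]$. -/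

import Mathlib

open Set Filter Topology

noncomputable section

namespace LeastAction

/-- The state space `ℝ^(m+s)` of `Z = [X; Y]`, with its Euclidean norm. -/
abbrev State (m s : ℕ) : Type := EuclideanSpace ℝ (Fin m ⊕ Fin s)

/-- The stacked vector `[x; y]`. -/
def stack {m s : ℕ} (x : EuclideanSpace ℝ (Fin m)) (y : EuclideanSpace ℝ (Fin s)) : State m s :=
  WithLp.toLp 2 (Sum.elim (fun i => x i) (fun i => y i))

/-- `f` is `C¹_b` on `[0,T] × E`: it is `C¹` jointly in time and space, and bounded together with
its first derivative. -/
def IsC1b {E F : Type*} [NormedAddCommGroup E] [NormedSpace ℝ E]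
    [NormedAddCommGroup F] [NormedSpace ℝ F] (T : ℝ) (f : ℝ → E → F) : Prop :=
  ContDiffOn ℝ 1 (fun p : ℝ × E => f p.1 p.2) (Icc 0 T ×ˢ univ) ∧
    ∃ C : ℝ, ∀ p ∈ Icc 0 T ×ˢ (univ : Set E),
      ‖f p.1 p.2‖ ≤ C ∧
        ‖fderivWithin ℝ (fun p : ℝ × E => f p.1 p.2) (Icc 0 T ×ˢ univ) p‖ ≤ C

/-- The number `N` of time steps of length `2⁻ⁿ`; one has `N 2⁻ⁿ = T` whenever `2ⁿ T` is an
integer. -/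
def numSteps (T : ℝ) (n : ℕ) : ℕ := ⌊T * 2 ^ n⌋₊

/-- The hidden part of a discrete path: the values at the times `j 2⁻ⁿ`, `0 ≤ j ≤ N`. -/
abbrev DiscretePath (m : ℕ) (T : ℝ) (n : ℕ) : Type :=
  Fin (numSteps T n + 1) → EuclideanSpace ℝ (Fin m)

/-- The log-likelihood `λ_n(x|y)` of the Euler–Maruyama scheme with step `h = 2⁻ⁿ`. -/
def discreteLogLik {m s : ℕ} (T : ℝ) (σ : ℝ → State m s → (State m s →L[ℝ] State m s))
    (μ : ℝ → State m s → State m s) (φ : EuclideanSpace ℝ (Fin m) → ℝ)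
    (y : ℝ → EuclideanSpace ℝ (Fin s)) (n : ℕ) (x : DiscretePath m T n) : ℝ :=
  let h : ℝ := (2 ^ n)⁻¹;
  (-(1 / 2) * (∑ j : Fin (numSteps T n),
      h * ‖(σ (j * h) (stack (x j.castSucc) (y (j * h)))).inverse
        (h⁻¹ • (stack (x j.succ) (y (j * h + h)) - stack (x j.castSucc) (y (j * h)))
          - μ (j * h) (stack (x j.castSucc) (y (j * h))))‖ ^ 2)
    - φ (x 0))

/-- The functional `Λ(x|y)`, meaningful for `C¹` paths `x` on `[0,T]`; the velocity is one-sided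
at the end points. -/
def contLogLik {m s : ℕ} (T : ℝ) (σ : ℝ → State m s → (State m s →L[ℝ] State m s))
    (μ : ℝ → State m s → State m s) (φ : EuclideanSpace ℝ (Fin m) → ℝ)
    (y : ℝ → EuclideanSpace ℝ (Fin s)) (x : ℝ → EuclideanSpace ℝ (Fin m)) : ℝ :=
  -(1 / 2) * (∫ t in (0 : ℝ)..T,
      ‖(σ t (stack (x t) (y t))).inverse
        (derivWithin (fun u => stack (x u) (y u)) (Icc 0 T) t
          - μ t (stack (x t) (y t)))‖ ^ 2)
    - φ (x 0)

/-- The `C¹` paths on `[0,T]` in `ℝ^m` (only the values on `[0,T]` matter). -/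
abbrev C1Path (m : ℕ) (T : ℝ) : Type :=
  {x : ℝ → EuclideanSpace ℝ (Fin m) // ContDiffOn ℝ 1 x (Icc 0 T)}

/-- The value at the `j`-th grid point, the index being truncated at `N`. -/
def DiscretePath.val {m : ℕ} {T : ℝ} {n : ℕ} (x : DiscretePath m T n) (j : ℕ) :
    EuclideanSpace ℝ (Fin m) :=
  x ⟨min j (numSteps T n), Nat.lt_succ_of_le (min_le_right _ _)⟩

/-- The piecewise linear path on `[0,T]` through the points of `x` at the times `j 2⁻ⁿ`. -/
def DiscretePath.interp {m : ℕ} {T : ℝ} {n : ℕ} (x : DiscretePath m T n) (t : ℝ) :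
    EuclideanSpace ℝ (Fin m) :=
  let j : ℕ := ⌊t * 2 ^ n⌋₊
  DiscretePath.val x j
    + (t * 2 ^ n - j) • (DiscretePath.val x (j + 1) - DiscretePath.val x j)

end LeastAction

end

/-! Values converge by an upper and a lower bound. For the upper bound, the restriction of a `C¹`
path to the grids has discrete actions that are perturbed Riemann sums of its continuous action
(`Regular.tendsto_action_grid`).

The lower bound rests on `C¹` compactness of discrete paths that minimize the action for a given
starting point. Such a path satisfies a discrete Euler–Lagrange inequality
(`Regular.first_variation`), where Lipschitz bounds replace the space derivatives of the
coefficients. Varying by a constant vector after one time bounds the momentum by a total impulse,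
hence by the action, which is at most that of the constant path. Varying on a time window makes the
momentum Lipschitz in time. Since `σ` is bounded, `σ⁻¹` is bounded below, and both facts pass to the
velocities, uniformly in the step size (`Regular.exists_velocity_bound`). Arzelà–Ascoli, run along
an ultrafilter, yields a `C¹` limit with uniform convergence of positions and velocities
(`Regular.exists_limit`), under which the actions converge (`Regular.tendsto_action`).

As `φ` need not be semicontinuous for the first claim, the limit path is translated to start exactly
where the discrete path starts, so the `φ` terms agree and only the action changes slightly. For the
second claim, semicontinuity makes each ultrafilter limit of discrete maximizers a maximizer of `Λ`;
uniqueness identifies it with `x*`. -/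

noncomputable section

namespace LeastAction

/-! ### Uniform calculus on `[0,T]`, difference quotients and Riemann sums. -/

section Calculus

variable {E : Type*} [NormedAddCommGroup E]

/-- A continuous function on a compact interval is uniformly continuous. -/
lemma exists_forall_norm_sub_le {T : ℝ} {f : ℝ → E} (hf : ContinuousOn f (Icc 0 T)) {ε : ℝ}
    (hε : 0 < ε) : ∃ δ > 0, ∀ s ∈ Icc 0 T, ∀ t ∈ Icc 0 T, |t - s| < δ → ‖f t - f s‖ ≤ ε := by
  have h := isCompact_Icc.uniformContinuousOn_of_continuous hf
  obtain ⟨δ, hδ, H⟩ := Metric.uniformContinuousOn_iff.1 h ε hε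
  refine ⟨δ, hδ, fun s hs t ht hst => ?_⟩
  have := H t ht s hs (by rwa [Real.dist_eq])
  rw [dist_eq_norm] at this
  exact this.le

lemma exists_forall_norm_le_of_continuousOn {T : ℝ} {f : ℝ → E} (hf : ContinuousOn f (Icc 0 T)) :
    ∃ C : ℝ, 0 ≤ C ∧ ∀ t ∈ Icc 0 T, ‖f t‖ ≤ C := by
  obtain ⟨C, hC⟩ := isCompact_Icc.exists_bound_of_continuousOn hf
  exact ⟨max C 0, le_max_right _ _, fun t ht => (hC t ht).trans (le_max_left _ _)⟩

/-- Pointwise convergence along a filter of an asymptotically equicontinuous family on a compact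
set is uniform. -/
lemma tendstoUniformlyOn_of_asymptotically_equicontinuous {ι : Type*} {l : Filter ι} [l.NeBot]
    {S : Set ℝ} (hS : IsCompact S) {F : ι → ℝ → E} {f : ℝ → E}
    (hF : ∀ ε > 0, ∃ δ > 0, ∀ᶠ n in l, ∀ s ∈ S, ∀ t ∈ S, |t - s| < δ → ‖F n t - F n s‖ ≤ ε)
    (hlim : ∀ t ∈ S, Tendsto (fun n => F n t) l (𝓝 (f t))) : TendstoUniformlyOn F f l S := by
  rw [Metric.tendstoUniformlyOn_iff]
  intro ε hε
  obtain ⟨δ, hδ, H⟩ := hF (ε / 4) (by positivity)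
  -- The limit inherits the modulus, even though each `F n` may have jumps.
  have Hf : ∀ s ∈ S, ∀ t ∈ S, |t - s| < δ → ‖f t - f s‖ ≤ ε / 4 := fun s hs t ht hst =>
    le_of_tendsto ((hlim t ht).sub (hlim s hs)).norm (H.mono fun n hn => hn s hs t ht hst)
  obtain ⟨A, hAS, hAfin, hA⟩ := hS.finite_cover_balls hδ
  have hconv : ∀ᶠ n in l, ∀ a ∈ A, dist (F n a) (f a) < ε / 4 :=
    (hAfin.eventually_all).2 fun a ha =>
      (Metric.tendsto_nhds.1 (hlim a (hAS ha))) (ε / 4) (by positivity)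
  filter_upwards [H, hconv] with n hn hc t ht
  obtain ⟨a, ha, hta⟩ := mem_iUnion₂.1 (hA ht)
  rw [Metric.mem_ball, Real.dist_eq] at hta
  have h1 := hn a (hAS ha) t ht hta
  have h2 := Hf a (hAS ha) t ht hta
  have h3 := hc a ha
  rw [← dist_eq_norm] at h1 h2
  have h4 := dist_triangle4 (f t) (f a) (F n a) (F n t)
  rw [dist_comm (f a) (F n a), dist_comm (F n a) (F n t)] at h4
  linarith

variable [NormedSpace ℝ E]

lemma continuousOn_derivWithin_Icc {T : ℝ} (hT : 0 < T) {x : ℝ → E}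
    (hx : ContDiffOn ℝ 1 x (Icc 0 T)) : ContinuousOn (derivWithin x (Icc 0 T)) (Icc 0 T) :=
  hx.continuousOn_derivWithin (uniqueDiffOn_Icc hT) le_rfl

lemma hasDerivWithinAt_Icc {T : ℝ} {x : ℝ → E} (hx : ContDiffOn ℝ 1 x (Icc 0 T)) {t : ℝ}
    (ht : t ∈ Icc 0 T) : HasDerivWithinAt x (derivWithin x (Icc 0 T) t) (Icc 0 T) t :=
  ((hx.differentiableOn one_ne_zero) t ht).hasDerivWithinAt

/-- A `C¹` path on a compact interval is uniformly differentiable. -/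
lemma exists_forall_norm_sub_sub_smul_le {T : ℝ} (hT : 0 < T) {x : ℝ → E}
    (hx : ContDiffOn ℝ 1 x (Icc 0 T)) {ε : ℝ} (hε : 0 < ε) :
    ∃ δ > 0, ∀ s ∈ Icc 0 T, ∀ t ∈ Icc 0 T, |t - s| < δ →
      ‖x t - x s - (t - s) • derivWithin x (Icc 0 T) s‖ ≤ ε * |t - s| := by
  obtain ⟨δ, hδ, H⟩ := exists_forall_norm_sub_le (continuousOn_derivWithin_Icc hT hx) hε
  refine ⟨δ, hδ, fun s hs t ht hst => ?_⟩
  have hsub : uIcc s t ⊆ Icc 0 T := uIcc_subset_Icc hs ht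
  -- Mean value inequality for `x u - u • x'(s)`, whose derivative `x'(u) - x'(s)` is small.
  have key := Convex.norm_image_sub_le_of_norm_hasDerivWithin_le (𝕜 := ℝ)
    (f := fun u => x u - u • derivWithin x (Icc 0 T) s)
    (f' := fun u => derivWithin x (Icc 0 T) u - (1 : ℝ) • derivWithin x (Icc 0 T) s)
    (s := uIcc s t) (x := s) (y := t) (C := ε)
    (fun u hu => ((hasDerivWithinAt_Icc hx (hsub hu)).mono hsub).sub
      ((hasDerivWithinAt_id u _).smul_const _))
    (fun u hu => by
      rw [one_smul]
      exact H s hs u (hsub hu) (lt_of_le_of_lt (abs_sub_left_of_mem_uIcc hu) hst))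
    (convex_uIcc s t) left_mem_uIcc right_mem_uIcc
  rw [Real.norm_eq_abs] at key
  convert key using 2
  rw [sub_smul]
  abel

/-- The forward difference quotients of a sequence, with step `h`. -/
def velocity (h : ℝ) (p : ℕ → E) (j : ℕ) : E := h⁻¹ • (p (j + 1) - p j)

lemma smul_velocity {h : ℝ} (hh : h ≠ 0) (p : ℕ → E) (j : ℕ) :
    h • velocity h p j = p (j + 1) - p j := by
  rw [velocity, smul_smul, mul_inv_cancel₀ hh, one_smul]

lemma sum_Ico_smul_velocity {h : ℝ} (hh : h ≠ 0) (p : ℕ → E) {i j : ℕ} (hij : i ≤ j) :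
    ∑ k ∈ Finset.Ico i j, h • velocity h p k = p j - p i := by
  simp_rw [smul_velocity hh]
  exact Finset.sum_Ico_sub p hij

/-- Discrete mean value inequality, by telescoping; `min` and `max` allow either order of the
indices. -/
lemma norm_sub_le_of_norm_velocity_le {h V : ℝ} (hh : 0 < h) {p : ℕ → E} {i j : ℕ}
    (hV : ∀ k, min i j ≤ k → k < max i j → ‖velocity h p k‖ ≤ V) :
    ‖p i - p j‖ ≤ V * |i * h - j * h| := by
  wlog hij : i ≤ j generalizing i j
  · rw [norm_sub_rev, abs_sub_comm]
    exact this (by rwa [min_comm, max_comm]) (by omega)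
  rw [min_eq_left hij, max_eq_right hij] at hV
  rw [norm_sub_rev, ← sum_Ico_smul_velocity hh.ne' p hij]
  have h1 : ∀ k ∈ Finset.Ico i j, ‖h • velocity h p k‖ ≤ h * V := fun k hk => by
    rw [norm_smul, Real.norm_eq_abs, abs_of_pos hh]
    have := hV k (Finset.mem_Ico.1 hk).1 (Finset.mem_Ico.1 hk).2
    gcongr
  refine (norm_sum_le_of_le _ h1).trans (le_of_eq ?_)
  rw [Finset.sum_const, Nat.card_Ico, nsmul_eq_mul, Nat.cast_sub hij, abs_sub_comm, ← sub_mul,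
    abs_of_nonneg]
  · ring
  · have : (i : ℝ) ≤ j := by exact_mod_cast hij
    exact mul_nonneg (by linarith) hh.le

lemma grid_mem_Icc {T h : ℝ} {N : ℕ} (hh : 0 < h) (hN : N * h = T) {j : ℕ} (hj : j ≤ N) :
    (j : ℝ) * h ∈ Icc 0 T := by
  refine ⟨by positivity, ?_⟩
  rw [← hN]
  gcongr

lemma exists_forall_norm_velocity_sub_le {T : ℝ} (hT : 0 < T) {x : ℝ → E}
    (hx : ContDiffOn ℝ 1 x (Icc 0 T)) {ε : ℝ} (hε : 0 < ε) :
    ∃ δ > 0, ∀ (h : ℝ) (N : ℕ), 0 < h → h < δ → N * h = T → ∀ j < N,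
      ‖velocity h (fun k => x (k * h)) j - derivWithin x (Icc 0 T) (j * h)‖ ≤ ε := by
  obtain ⟨δ, hδ, H⟩ := exists_forall_norm_sub_sub_smul_le hT hx hε
  refine ⟨δ, hδ, fun h N hh hhδ hN j hj => ?_⟩
  have e : (((j + 1 : ℕ) : ℝ) * h - j * h) = h := by push_cast; ring
  have key := H (j * h) (grid_mem_Icc hh hN hj.le) ((j + 1 : ℕ) * h) (grid_mem_Icc hh hN hj)
    (by rw [e, abs_of_pos hh]; exact hhδ)
  rw [e, abs_of_pos hh] at key
  have : velocity h (fun k => x (k * h)) j - derivWithin x (Icc 0 T) (j * h)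
      = h⁻¹ • (x ((j + 1 : ℕ) * h) - x (j * h) - h • derivWithin x (Icc 0 T) (j * h)) := by
    rw [velocity, smul_sub h⁻¹ _ (h • _), smul_smul, inv_mul_cancel₀ hh.ne', one_smul]
  rw [this, norm_smul, norm_inv, Real.norm_eq_abs, abs_of_pos hh, inv_mul_le_iff₀ hh]
  linarith

lemma tendsto_riemann_sum {ι : Type*} {l : Filter ι} {T : ℝ} (hT : 0 < T) {h : ι → ℝ} {N : ι → ℕ}
    (h0 : Tendsto h l (𝓝 0)) (hN : ∀ᶠ n in l, 0 < h n ∧ N n * h n = T) {f : ℝ → ℝ}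
    (hf : ContinuousOn f (Icc 0 T)) :
    Tendsto (fun n => ∑ j ∈ Finset.range (N n), h n * f (j * h n)) l
      (𝓝 (∫ t in (0 : ℝ)..T, f t)) := by
  rw [Metric.tendsto_nhds]
  intro ε hε
  have hε' : 0 < ε / (2 * T) := by positivity
  obtain ⟨δ, hδ, H⟩ := exists_forall_norm_sub_le hf hε'
  filter_upwards [hN, h0.eventually (gt_mem_nhds hδ)] with n ⟨hn, hNn⟩ hnδ
  have hsub : ∀ j < N n, uIcc ((j : ℕ) * h n) ((j + 1 : ℕ) * h n) ⊆ Icc 0 T := fun j hj =>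
    uIcc_subset_Icc (grid_mem_Icc hn hNn hj.le) (grid_mem_Icc hn hNn hj)
  have hint : ∀ j < N n, IntervalIntegrable f MeasureTheory.volume
      ((j : ℕ) * h n) ((j + 1 : ℕ) * h n) := fun j hj =>
    (hf.mono (hsub j hj)).intervalIntegrable
  have hsum := intervalIntegral.sum_integral_adjacent_intervals (f := f)
    (μ := MeasureTheory.volume) (a := fun j : ℕ => (j : ℝ) * h n) (n := N n) hint
  simp only [Nat.cast_zero, zero_mul, hNn] at hsum
  rw [← hsum, dist_eq_norm, ← Finset.sum_sub_distrib]
  have hterm : ∀ j ∈ Finset.range (N n),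
      ‖h n * f (j * h n) - ∫ t in ((j : ℕ) * h n)..((j + 1 : ℕ) * h n), f t‖
        ≤ ε / (2 * T) * h n := by
    intro j hj
    have hj := Finset.mem_range.1 hj
    have e : (((j + 1 : ℕ) : ℝ) * h n - j * h n) = h n := by push_cast; ring
    have hc : h n * f (j * h n)
        = ∫ _ in ((j : ℕ) * h n)..((j + 1 : ℕ) * h n), f (j * h n) := by
      rw [intervalIntegral.integral_const, e, smul_eq_mul]
    rw [hc, ← intervalIntegral.integral_sub intervalIntegrable_const (hint j hj)]
    have := intervalIntegral.norm_integral_le_of_norm_le_const (a := (j : ℕ) * h n)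
      (b := (j + 1 : ℕ) * h n) (f := fun t => f (j * h n) - f t) (C := ε / (2 * T)) ?_
    · rwa [e, abs_of_pos hn] at this
    · intro t ht
      have ht' := uIoc_subset_uIcc ht
      rw [norm_sub_rev]
      refine H _ (grid_mem_Icc hn hNn hj.le) _ (hsub j hj ht') ?_
      refine lt_of_le_of_lt (abs_sub_left_of_mem_uIcc ht') ?_
      rwa [e, abs_of_pos hn]
  refine (norm_sum_le_of_le _ hterm).trans_lt ?_
  rw [Finset.sum_const, Finset.card_range, nsmul_eq_mul]
  calc (N n : ℝ) * (ε / (2 * T) * h n) = ε / (2 * T) * (N n * h n) := by ring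
    _ = ε / 2 := by rw [hNn]; field_simp
    _ < ε := by linarith

end Calculus

/-! ### The discrete action and its first variation. -/

section DiscreteAction

variable {X F H : Type*} [NormedAddCommGroup X] [NormedSpace ℝ X] [NormedAddCommGroup F]
  [NormedSpace ℝ F] [NormedAddCommGroup H] [InnerProductSpace ℝ H]

/-- The coefficients of a residual `B t x v + D t x r + c t x` which is affine in the velocity `v`
of the controlled path and in the velocity `r` of a given path. -/
structure Residual (X F H : Type*) [NormedAddCommGroup X] [NormedSpace ℝ X]
    [NormedAddCommGroup F] [NormedSpace ℝ F] [NormedAddCommGroup H] [InnerProductSpace ℝ H] where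
  /-- the coefficient of the velocity of the controlled path -/
  B : ℝ → X → X →L[ℝ] H
  /-- the coefficient of the velocity of the given path -/
  D : ℝ → X → F →L[ℝ] H
  /-- the drift -/
  c : ℝ → X → H

namespace Residual

/-- The value of the residual. -/
def eval (L : Residual X F H) (t : ℝ) (x v : X) (r : F) : H := L.B t x v + L.D t x r + L.c t x

/-- The coefficients are bounded and Lipschitz on `[0,T]`, and the residual is coercive in the
velocity. -/
structure Regular (L : Residual X F H) (T C : ℝ) : Prop where
  one_le : 1 ≤ C
  norm_B_le : ∀ t ∈ Icc 0 T, ∀ x, ‖L.B t x‖ ≤ C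
  norm_D_le : ∀ t ∈ Icc 0 T, ∀ x, ‖L.D t x‖ ≤ C
  norm_c_le : ∀ t ∈ Icc 0 T, ∀ x, ‖L.c t x‖ ≤ C
  lip_B : ∀ t ∈ Icc 0 T, ∀ t' ∈ Icc 0 T, ∀ x x',
    ‖L.B t x - L.B t' x'‖ ≤ C * (|t - t'| + ‖x - x'‖)
  lip_D : ∀ t ∈ Icc 0 T, ∀ t' ∈ Icc 0 T, ∀ x x',
    ‖L.D t x - L.D t' x'‖ ≤ C * (|t - t'| + ‖x - x'‖)
  lip_c : ∀ t ∈ Icc 0 T, ∀ t' ∈ Icc 0 T, ∀ x x',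
    ‖L.c t x - L.c t' x'‖ ≤ C * (|t - t'| + ‖x - x'‖)
  le_norm_B : ∀ t ∈ Icc 0 T, ∀ x v, ‖v‖ ≤ C * ‖L.B t x v‖
  le_norm_eval : ∀ t ∈ Icc 0 T, ∀ x v r, ‖v‖ ≤ C * (‖L.eval t x v r‖ + 1)

lemma Regular.nonneg {L : Residual X F H} {T C : ℝ} (hL : L.Regular T C) : 0 ≤ C :=
  zero_le_one.trans hL.one_le

lemma Regular.norm_B_apply_le {L : Residual X F H} {T C : ℝ} (hL : L.Regular T C) {t : ℝ}
    (ht : t ∈ Icc 0 T) (x v : X) : ‖L.B t x v‖ ≤ C * ‖v‖ :=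
  (L.B t x).le_of_opNorm_le (hL.norm_B_le t ht x) v

lemma Regular.norm_force_le {L : Residual X F H} {T C : ℝ} (hL : L.Regular T C) {t : ℝ}
    (ht : t ∈ Icc 0 T) (x : X) (r : F) : ‖L.D t x r + L.c t x‖ ≤ C * (1 + ‖r‖) := by
  have h1 := (L.D t x).le_of_opNorm_le (hL.norm_D_le t ht x) r
  have h2 := hL.norm_c_le t ht x
  have h3 := norm_add_le (L.D t x r) (L.c t x)
  linarith

lemma Regular.norm_eval_le {L : Residual X F H} {T C : ℝ} (hL : L.Regular T C) {t : ℝ}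
    (ht : t ∈ Icc 0 T) (x v : X) (r : F) : ‖L.eval t x v r‖ ≤ C * (1 + ‖v‖ + ‖r‖) := by
  have h1 := hL.norm_B_apply_le ht x v
  have h2 := hL.norm_force_le ht x r
  have h3 := norm_add_le (L.B t x v) (L.D t x r + L.c t x)
  rw [eval, add_assoc]
  linarith

lemma Regular.norm_B_sub_apply_le {L : Residual X F H} {T C : ℝ} (hL : L.Regular T C) {t t' : ℝ}
    (ht : t ∈ Icc 0 T) (ht' : t' ∈ Icc 0 T) (x x' v : X) :
    ‖L.B t x v - L.B t' x' v‖ ≤ C * (|t - t'| + ‖x - x'‖) * ‖v‖ :=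
  (L.B t x - L.B t' x').le_of_opNorm_le (hL.lip_B t ht t' ht' x x') v

lemma Regular.norm_force_sub_le {L : Residual X F H} {T C : ℝ} (hL : L.Regular T C) {t t' : ℝ}
    (ht : t ∈ Icc 0 T) (ht' : t' ∈ Icc 0 T) (x x' : X) (r r' : F) :
    ‖L.D t x r + L.c t x - (L.D t' x' r' + L.c t' x')‖
      ≤ C * (|t - t'| + ‖x - x'‖) * (1 + ‖r‖) + C * ‖r - r'‖ := by
  have h1 : ‖L.D t x r - L.D t' x' r‖ ≤ C * (|t - t'| + ‖x - x'‖) * ‖r‖ :=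
    (L.D t x - L.D t' x').le_of_opNorm_le (hL.lip_D t ht t' ht' x x') r
  have h2 := (L.D t' x').le_of_opNorm_le (hL.norm_D_le t' ht' x') (r - r')
  have h3 := hL.lip_c t ht t' ht' x x'
  have e : L.D t x r + L.c t x - (L.D t' x' r' + L.c t' x')
      = (L.D t x r - L.D t' x' r) + L.D t' x' (r - r') + (L.c t x - L.c t' x') := by
    rw [map_sub]; abel
  rw [e]
  refine (norm_add₃_le).trans ?_
  linarith

/-- The bound is asymmetric: only the unprimed velocities multiply the Lipschitz increment, so a
priori bounds are needed for one of the two paths only. -/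
lemma Regular.norm_eval_sub_le {L : Residual X F H} {T C : ℝ} (hL : L.Regular T C) {t t' : ℝ}
    (ht : t ∈ Icc 0 T) (ht' : t' ∈ Icc 0 T) (x x' v v' : X) (r r' : F) :
    ‖L.eval t x v r - L.eval t' x' v' r'‖
      ≤ C * (|t - t'| + ‖x - x'‖) * (1 + ‖v‖ + ‖r‖) + C * (‖v - v'‖ + ‖r - r'‖) := by
  have h1 := hL.norm_B_sub_apply_le ht ht' x x' v
  have h2 := hL.norm_B_apply_le ht' x' (v - v')
  have h3 := hL.norm_force_sub_le ht ht' x x' r r'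
  have e : L.eval t x v r - L.eval t' x' v' r'
      = (L.B t x v - L.B t' x' v) + L.B t' x' (v - v')
        + (L.D t x r + L.c t x - (L.D t' x' r' + L.c t' x')) := by
    rw [map_sub, eval, eval]; abel
  rw [e]
  refine (norm_add₃_le).trans ?_
  linarith

/-- The residual of a discrete path at its `j`-th step. -/
def step (L : Residual X F H) (h : ℝ) (p : ℕ → X) (r : ℕ → F) (j : ℕ) : H :=
  L.eval (j * h) (p j) (velocity h p j) (r j)

/-- The discrete action. -/
def action (L : Residual X F H) (h : ℝ) (N : ℕ) (p : ℕ → X) (r : ℕ → F) : ℝ :=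
  ∑ j ∈ Finset.range N, h * ‖L.step h p r j‖ ^ 2

/-- `p` minimizes the discrete action among the paths with the same starting point. -/
def IsMinimal (L : Residual X F H) (h : ℝ) (N : ℕ) (p : ℕ → X) (r : ℕ → F) : Prop :=
  ∀ q : ℕ → X, q 0 = p 0 → L.action h N p r ≤ L.action h N q r

lemma action_nonneg (L : Residual X F H) {h : ℝ} (hh : 0 ≤ h) (N : ℕ) (p : ℕ → X) (r : ℕ → F) :
    0 ≤ L.action h N p r :=
  Finset.sum_nonneg fun _ _ => by positivity

lemma action_congr (L : Residual X F H) {h : ℝ} {N : ℕ} {p q : ℕ → X} (r : ℕ → F)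
    (hpq : ∀ j ≤ N, p j = q j) : L.action h N p r = L.action h N q r := by
  refine Finset.sum_congr rfl fun j hj => ?_
  have hj := Finset.mem_range.1 hj
  simp only [step, velocity, hpq j hj.le, hpq (j + 1) hj]

/-- Expansion of the squared residual under a variation of position and velocity. -/
lemma Regular.exists_norm_sq_eval_add_le {L : Residual X F H} {T C : ℝ} (hL : L.Regular T C)
    {t : ℝ} (ht : t ∈ Icc 0 T) (x v η δ : X) (r : F) :
    ∃ M, ∀ ε : ℝ, 0 < ε → ε ≤ 1 → ‖L.eval t (x + ε • η) (v + ε • δ) r‖ ^ 2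
      ≤ ‖L.eval t x v r‖ ^ 2 + ε * (2 * (inner ℝ (L.eval t x v r) (L.B t x δ)
        + C * ‖L.eval t x v r‖ * ‖η‖ * (1 + ‖v‖ + ‖r‖))) + ε ^ 2 * M := by
  have hC := hL.nonneg
  set w := L.eval t x v r with hw
  set a := C * ‖η‖ * (1 + ‖v‖ + ‖r‖) with ha
  set b := C * ‖η‖ * ‖δ‖ with hb
  have ha0 : 0 ≤ a := by positivity
  have hb0 : 0 ≤ b := by positivity
  refine ⟨2 * ‖w‖ * b + (C * ‖δ‖ + a + b) ^ 2, fun ε hε hε1 => ?_⟩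
  -- Remainder after the term linear in `δ`. Its first part is only `O(ε)`, the coefficients being
  -- Lipschitz in `x`; paired with `w` it gives the error term of the first variation. Its second
  -- part is `O(ε²)`.
  set R := (L.eval t (x + ε • η) v r - w) + ε • (L.B t (x + ε • η) δ - L.B t x δ) with hR
  have e : L.eval t (x + ε • η) (v + ε • δ) r = w + (ε • L.B t x δ + R) := by
    rw [hR, eval, eval, map_add, map_smul, smul_sub]; abel
  have hη : ‖x + ε • η - x‖ = ε * ‖η‖ := by
    rw [add_sub_cancel_left, norm_smul, Real.norm_eq_abs, abs_of_pos hε]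
  have hR1 : ‖R‖ ≤ ε * a + ε ^ 2 * b := by
    have h1 := hL.norm_eval_sub_le ht ht (x + ε • η) x v v r r
    have h2 := hL.norm_B_sub_apply_le ht ht (x + ε • η) x δ
    rw [hη] at h1 h2
    simp only [sub_self, abs_zero, norm_zero, zero_add, mul_zero, add_zero] at h1 h2
    refine (norm_add_le _ _).trans ?_
    rw [norm_smul, Real.norm_eq_abs, abs_of_pos hε]
    calc _ ≤ C * (ε * ‖η‖) * (1 + ‖v‖ + ‖r‖) + ε * (C * (ε * ‖η‖) * ‖δ‖) := by gcongr
      _ = _ := by rw [ha, hb]; ring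
  have hd : ‖ε • L.B t x δ + R‖ ≤ ε * (C * ‖δ‖ + a + b) := by
    refine (norm_add_le _ _).trans ?_
    rw [norm_smul, Real.norm_eq_abs, abs_of_pos hε]
    have h1 := mul_le_mul_of_nonneg_left (hL.norm_B_apply_le ht x δ) hε.le
    have h2 : ε ^ 2 * b ≤ ε * b := mul_le_mul_of_nonneg_right (by nlinarith) hb0
    linarith
  have hin : inner ℝ w R ≤ ‖w‖ * (ε * a + ε ^ 2 * b) :=
    (real_inner_le_norm _ _).trans (by gcongr)
  have hsq : ‖ε • L.B t x δ + R‖ ^ 2 ≤ ε ^ 2 * (C * ‖δ‖ + a + b) ^ 2 := by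
    rw [← mul_pow]; gcongr
  rw [e, norm_add_sq_real, inner_add_right, real_inner_smul_right]
  have : C * ‖w‖ * ‖η‖ * (1 + ‖v‖ + ‖r‖) = ‖w‖ * a := by rw [ha]; ring
  rw [this]
  linarith

/-- Divide by `ε` and let `ε ↓ 0`. -/
lemma nonneg_of_forall_mul_add_sq_mul {a M : ℝ}
    (h : ∀ ε : ℝ, 0 < ε → ε ≤ 1 → 0 ≤ ε * a + ε ^ 2 * M) : 0 ≤ a := by
  have hlim : Tendsto (fun ε : ℝ => a + ε * M) (𝓝[>] 0) (𝓝 a) := by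
    have : Tendsto (fun ε : ℝ => a + ε * M) (𝓝 0) (𝓝 (a + 0 * M)) := by
      apply Continuous.tendsto; fun_prop
    rw [zero_mul, add_zero] at this
    exact this.mono_left nhdsWithin_le_nhds
  refine ge_of_tendsto hlim ?_
  filter_upwards [Ioc_mem_nhdsGT (zero_lt_one' ℝ)] with ε hε
  have := h ε hε.1 hε.2
  have h2 : 0 ≤ ε * (a + ε * M) := by linarith
  exact nonneg_of_mul_nonneg_right h2 hε.1

lemma velocity_add_smul (h : ℝ) (p η : ℕ → X) (ε : ℝ) (j : ℕ) :
    velocity h (fun k => p k + ε • η k) j = velocity h p j + ε • velocity h η j := by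
  simp only [velocity, smul_sub, smul_add, smul_comm h⁻¹ ε]
  abel

/-- The first variation of the discrete action at a minimal path, with an error term that only
involves the Lipschitz constant of the coefficients. -/
lemma Regular.first_variation {L : Residual X F H} {T C : ℝ} (hL : L.Regular T C) {h : ℝ}
    {N : ℕ} (hh : 0 < h) (hN : N * h = T) {p : ℕ → X} {r : ℕ → F} (hp : L.IsMinimal h N p r)
    (η : ℕ → X) (hη : η 0 = 0) :
    0 ≤ ∑ j ∈ Finset.range N, (inner ℝ (L.step h p r j) (L.B (j * h) (p j) (η (j + 1) - η j))
      + h * (C * ‖L.step h p r j‖ * ‖η j‖ * (1 + ‖velocity h p j‖ + ‖r j‖))) := by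
  -- The condition `j < N` sits under the existential so that `choose` produces a sequence `M` on
  -- all of `ℕ`.
  have hM : ∀ j : ℕ, ∃ M, j < N → ∀ ε : ℝ, 0 < ε → ε ≤ 1 →
      ‖L.step h (fun k => p k + ε • η k) r j‖ ^ 2 ≤ ‖L.step h p r j‖ ^ 2
        + ε * (2 * (inner ℝ (L.step h p r j) (L.B (j * h) (p j) (velocity h η j))
        + C * ‖L.step h p r j‖ * ‖η j‖ * (1 + ‖velocity h p j‖ + ‖r j‖))) + ε ^ 2 * M := by
    intro j
    by_cases hj : j < N
    · obtain ⟨M, hM⟩ := hL.exists_norm_sq_eval_add_le (grid_mem_Icc hh hN hj.le) (p j)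
        (velocity h p j) (η j) (velocity h η j) (r j)
      refine ⟨M, fun _ ε hε hε1 => ?_⟩
      have := hM ε hε hε1
      rwa [← velocity_add_smul] at this
    · exact ⟨0, fun h => absurd h hj⟩
  choose M hM using hM
  set S := ∑ j ∈ Finset.range N, (inner ℝ (L.step h p r j) (L.B (j * h) (p j) (η (j + 1) - η j))
      + h * (C * ‖L.step h p r j‖ * ‖η j‖ * (1 + ‖velocity h p j‖ + ‖r j‖))) with hS
  suffices h2 : 0 ≤ 2 * S by linarith
  refine nonneg_of_forall_mul_add_sq_mul (M := ∑ j ∈ Finset.range N, h * M j) fun ε hε hε1 => ?_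
  have hmin := hp (fun k => p k + ε • η k) (by simp [hη])
  have hle : L.action h N (fun k => p k + ε • η k) r
      ≤ L.action h N p r + (ε * (2 * S) + ε ^ 2 * ∑ j ∈ Finset.range N, h * M j) := by
    rw [action, action, hS, Finset.mul_sum, Finset.mul_sum, Finset.mul_sum,
      ← Finset.sum_add_distrib, ← Finset.sum_add_distrib]
    refine Finset.sum_le_sum fun j hj => ?_
    have h1 := mul_le_mul_of_nonneg_left (hM j (Finset.mem_range.1 hj) ε hε hε1) hh.le
    rw [← smul_velocity hh.ne' η j, map_smul, real_inner_smul_right]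
    refine h1.trans (le_of_eq ?_)
    ring
  linarith

end Residual

end DiscreteAction

/-! ### Momentum and velocity estimates, and existence of minimal discrete paths. -/

section DiscreteEstimates

variable {X F H : Type*} [NormedAddCommGroup X] [NormedSpace ℝ X] [NormedAddCommGroup F]
  [NormedSpace ℝ F] [NormedAddCommGroup H] [InnerProductSpace ℝ H]

namespace Residual

lemma Regular.action_const_le {L : Residual X F H} {T C : ℝ} (hL : L.Regular T C) {h : ℝ}
    {N : ℕ} (hh : 0 < h) (hN : N * h = T) {r : ℕ → F} (hr : ∀ j < N, ‖r j‖ ≤ C) (x₀ : X) :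
    L.action h N (fun _ => x₀) r ≤ T * (C * (1 + C)) ^ 2 := by
  have hC := hL.nonneg
  have : ∀ j ∈ Finset.range N, h * ‖L.step h (fun _ => x₀) r j‖ ^ 2
      ≤ h * (C * (1 + C)) ^ 2 := by
    intro j hj
    have hj := Finset.mem_range.1 hj
    have h1 := hL.norm_eval_le (grid_mem_Icc hh hN hj.le) x₀ (velocity h (fun _ => x₀) j) (r j)
    have h2 : velocity h (fun _ : ℕ => x₀) j = 0 := by simp [velocity]
    rw [h2, norm_zero, add_zero] at h1
    rw [step, h2]
    have h3 := hr j hj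
    gcongr
    exact h1.trans (by gcongr)
  refine (Finset.sum_le_sum this).trans (le_of_eq ?_)
  rw [Finset.sum_const, Finset.card_range, nsmul_eq_mul, ← mul_assoc, hN]

/-- The momentum in direction `ξ` of a discrete path at its `j`-th step. -/
def momentum (L : Residual X F H) (h : ℝ) (p : ℕ → X) (r : ℕ → F) (j : ℕ) (ξ : X) : ℝ :=
  inner ℝ (L.step h p r j) (L.B (j * h) (p j) ξ)

lemma momentum_neg (L : Residual X F H) (h : ℝ) (p : ℕ → X) (r : ℕ → F) (j : ℕ) (ξ : X) :
    L.momentum h p r j (-ξ) = -L.momentum h p r j ξ := by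
  rw [momentum, map_neg, inner_neg_right, momentum]

/-- The coefficient of the error term in the first variation. -/
def impulse (L : Residual X F H) (C h : ℝ) (p : ℕ → X) (r : ℕ → F) (j : ℕ) : ℝ :=
  C * ‖L.step h p r j‖ * (1 + ‖velocity h p j‖ + ‖r j‖)

lemma Regular.impulse_nonneg {L : Residual X F H} {T C : ℝ} (hL : L.Regular T C) (h : ℝ)
    (p : ℕ → X) (r : ℕ → F) (j : ℕ) : 0 ≤ L.impulse C h p r j := by
  have := hL.nonneg
  rw [impulse]; positivity

/-- The variation equal to `ξ` after index `i` and `0` up to it changes the velocity at step `i`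
only, so a single momentum survives in the first variation. -/
lemma Regular.neg_momentum_le {L : Residual X F H} {T C : ℝ} (hL : L.Regular T C) {h : ℝ}
    {N : ℕ} (hh : 0 < h) (hN : N * h = T) {p : ℕ → X} {r : ℕ → F} (hp : L.IsMinimal h N p r)
    {i : ℕ} (hi : i < N) (ξ : X) :
    -L.momentum h p r i ξ ≤ (∑ j ∈ Finset.range N, h * L.impulse C h p r j) * ‖ξ‖ := by
  have key := hL.first_variation hh hN hp (fun k => if i < k then ξ else 0) (by simp)
  rw [Finset.sum_add_distrib] at key
  have h1 : ∑ j ∈ Finset.range N, inner ℝ (L.step h p r j)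
      (L.B (j * h) (p j) ((if i < j + 1 then ξ else 0) - if i < j then ξ else 0))
        = L.momentum h p r i ξ := by
    rw [Finset.sum_eq_single_of_mem i (Finset.mem_range.2 hi)]
    · simp [momentum]
    · intro j _ hj
      have : (i < j + 1) ↔ i < j := by omega
      simp [this]
  have h2 : ∑ j ∈ Finset.range N, h * (C * ‖L.step h p r j‖ * ‖if i < j then ξ else 0‖
      * (1 + ‖velocity h p j‖ + ‖r j‖))
        ≤ (∑ j ∈ Finset.range N, h * L.impulse C h p r j) * ‖ξ‖ := by
    rw [Finset.sum_mul]
    refine Finset.sum_le_sum fun j _ => ?_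
    have h3 : ‖if i < j then ξ else 0‖ ≤ ‖ξ‖ := by split_ifs <;> simp
    have h4 := mul_le_mul_of_nonneg_left h3 (mul_nonneg hh.le (hL.impulse_nonneg h p r j))
    refine le_trans (le_of_eq ?_) h4
    rw [impulse]; ring
  rw [h1] at key
  linarith

/-- The variation equal to `ξ` on `(i, k]` switches on at step `i` and off at step `k`, so the
difference of two momenta appears, with error terms from only `k - i` steps. -/
lemma Regular.momentum_sub_le {L : Residual X F H} {T C : ℝ} (hL : L.Regular T C) {h : ℝ}
    {N : ℕ} (hh : 0 < h) (hN : N * h = T) {p : ℕ → X} {r : ℕ → F} (hp : L.IsMinimal h N p r)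
    {K : ℝ} (hK : ∀ j < N, L.impulse C h p r j ≤ K) {i k : ℕ} (hik : i ≤ k) (hk : k < N) (ξ : X) :
    L.momentum h p r k ξ - L.momentum h p r i ξ ≤ K * ((k - i) * h) * ‖ξ‖ := by
  have key := hL.first_variation hh hN hp (fun j => if j ∈ Finset.Ioc i k then ξ else 0) (by simp)
  rw [Finset.sum_add_distrib] at key
  have h1 : ∑ j ∈ Finset.range N, inner ℝ (L.step h p r j)
      (L.B (j * h) (p j) ((if j + 1 ∈ Finset.Ioc i k then ξ else 0)
        - if j ∈ Finset.Ioc i k then ξ else 0))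
        = L.momentum h p r i ξ - L.momentum h p r k ξ := by
    have e : ∀ j : ℕ, ((if j + 1 ∈ Finset.Ioc i k then ξ else 0)
        - if j ∈ Finset.Ioc i k then ξ else 0)
          = (if j = i then ξ else 0) - if j = k then ξ else 0 := by
      intro j
      simp only [Finset.mem_Ioc]
      by_cases h1 : j = i <;> by_cases h2 : j = k
      · rw [if_neg (by omega), if_neg (by omega), if_pos h1, if_pos h2, sub_self, sub_self]
      · rw [if_pos (by omega), if_neg (by omega), if_pos h1, if_neg h2]
      · rw [if_neg (by omega), if_pos (by omega), if_neg h1, if_pos h2]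
      · by_cases h3 : i < j ∧ j ≤ k
        · rw [if_pos (by omega), if_pos h3, if_neg h1, if_neg h2, sub_self, sub_self]
        · rw [if_neg (by omega), if_neg h3, if_neg h1, if_neg h2]
    simp_rw [e, map_sub, inner_sub_right]
    rw [Finset.sum_sub_distrib, Finset.sum_eq_single_of_mem i (Finset.mem_range.2 (by omega)),
      Finset.sum_eq_single_of_mem k (Finset.mem_range.2 hk)]
    · simp [momentum]
    · intro j _ hj; simp [hj]
    · intro j _ hj; simp [hj]
  have h2 : ∑ j ∈ Finset.range N, h * (C * ‖L.step h p r j‖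
      * ‖if j ∈ Finset.Ioc i k then ξ else 0‖ * (1 + ‖velocity h p j‖ + ‖r j‖))
        ≤ K * ((k - i) * h) * ‖ξ‖ := by
    have hsub : Finset.Ioc i k ⊆ Finset.range N := fun j hj => by
      have := Finset.mem_Ioc.1 hj
      exact Finset.mem_range.2 (by omega)
    rw [← Finset.sum_subset hsub]
    · have : ∀ j ∈ Finset.Ioc i k, h * (C * ‖L.step h p r j‖
          * ‖if j ∈ Finset.Ioc i k then ξ else 0‖ * (1 + ‖velocity h p j‖ + ‖r j‖))
            ≤ h * K * ‖ξ‖ := by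
        intro j hj
        rw [if_pos hj]
        have h3 := hK j (Finset.mem_range.1 (hsub hj))
        have h4 : h * L.impulse C h p r j * ‖ξ‖ ≤ h * K * ‖ξ‖ := by gcongr
        refine le_trans (le_of_eq ?_) h4
        rw [impulse]; ring
      refine (Finset.sum_le_sum this).trans (le_of_eq ?_)
      rw [Finset.sum_const, Nat.card_Ioc, nsmul_eq_mul, Nat.cast_sub hik]
      ring
    · intro j _ hj
      simp [hj]
  rw [h1] at key
  linarith

/-- By coercivity the velocity is at most affine in the residual, so the impulse is at most
quadratic in it and the action controls the sum. -/
lemma Regular.sum_impulse_le {L : Residual X F H} {T C : ℝ} (hL : L.Regular T C) {h : ℝ}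
    {N : ℕ} (hh : 0 < h) (hN : N * h = T) (p : ℕ → X) {r : ℕ → F} (hr : ∀ j < N, ‖r j‖ ≤ C) :
    ∑ j ∈ Finset.range N, h * L.impulse C h p r j
      ≤ C * (1 + 3 * C) * (T + L.action h N p r) := by
  have hC := hL.nonneg
  have : ∀ j ∈ Finset.range N, h * L.impulse C h p r j
      ≤ C * (1 + 3 * C) * (h + h * ‖L.step h p r j‖ ^ 2) := by
    intro j hj
    have hj := Finset.mem_range.1 hj
    have h1 := hL.le_norm_eval _ (grid_mem_Icc hh hN hj.le) (p j) (velocity h p j) (r j)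
    change _ ≤ C * (‖L.step h p r j‖ + 1) at h1
    have h2 := hr j hj
    rw [impulse]
    set w := ‖L.step h p r j‖ with hw
    have hw0 : 0 ≤ w := norm_nonneg _
    have h3 : w * (1 + ‖velocity h p j‖ + ‖r j‖) ≤ (1 + 3 * C) * (1 + w ^ 2) := by
      have : w * (1 + ‖velocity h p j‖ + ‖r j‖) ≤ w * (1 + C * (w + 1) + C) := by gcongr
      have h4 : w ≤ 1 + w ^ 2 := by nlinarith
      have h5 : w * (1 + C * (w + 1) + C) = (1 + 2 * C) * w + C * w ^ 2 := by ring
      have h6 := mul_le_mul_of_nonneg_left h4 (by positivity : 0 ≤ 1 + 2 * C)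
      linarith
    have h4 := mul_le_mul_of_nonneg_left h3 (mul_nonneg hh.le hC)
    refine le_trans (le_of_eq ?_) (h4.trans (le_of_eq ?_)) <;> ring
  refine (Finset.sum_le_sum this).trans (le_of_eq ?_)
  rw [← Finset.mul_sum, Finset.sum_add_distrib, Finset.sum_const, Finset.card_range,
    nsmul_eq_mul, hN, action]

/-- Take `ξ` to be the velocity itself: the momentum is then `‖B v‖ ^ 2` plus a term linear in `B
v`. -/
lemma Regular.norm_velocity_le_of_momentum {L : Residual X F H} {T C : ℝ} (hL : L.Regular T C)
    {h : ℝ} {p : ℕ → X} {r : ℕ → F} {K : ℝ} (hK0 : 0 ≤ K) {j : ℕ} (hj : (j : ℝ) * h ∈ Icc 0 T)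
    (hr : ‖r j‖ ≤ C) (hK : ∀ ξ, L.momentum h p r j ξ ≤ K * ‖ξ‖) :
    ‖velocity h p j‖ ≤ C * (K * C + C * (1 + C)) := by
  have hC := hL.nonneg
  set v := velocity h p j with hv
  set b := L.B (j * h) (p j) v with hb
  have h1 := hK v
  have h2 := hL.norm_force_le hj (p j) (r j)
  set g := L.D (j * h) (p j) (r j) + L.c (j * h) (p j) with hg
  have e : L.momentum h p r j v = ‖b‖ ^ 2 + inner ℝ g b := by
    rw [momentum, step, eval, add_assoc, inner_add_left, real_inner_self_eq_norm_sq]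
  have h3 : -inner ℝ g b ≤ ‖g‖ * ‖b‖ := by
    have := (abs_le.1 (abs_real_inner_le_norm g b)).1
    linarith
  have h4 : ‖v‖ ≤ C * ‖b‖ := hL.le_norm_B _ hj (p j) v
  have h5 : ‖g‖ ≤ C * (1 + C) := h2.trans (by gcongr)
  have h6 : ‖b‖ ≤ K * C + C * (1 + C) := by
    by_contra hlt
    push Not at hlt
    have hb0 : 0 < ‖b‖ := lt_of_le_of_lt (by positivity) hlt
    have h7 : ‖b‖ ^ 2 ≤ (K * C + C * (1 + C)) * ‖b‖ := by
      have h8 : K * ‖v‖ ≤ K * (C * ‖b‖) := by gcongr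
      have h9 : ‖g‖ * ‖b‖ ≤ C * (1 + C) * ‖b‖ := by gcongr
      linarith
    nlinarith
  exact h4.trans (by gcongr)

/-- Take `ξ = d`, the difference of the velocities: the momentum difference contains `‖Bi d‖ ^ 2`,
and every other term is linear in `d` with a small factor, coming from the change of the
coefficients or of `r`. -/
lemma Regular.norm_velocity_sub_le_of_momentum {L : Residual X F H} {T C : ℝ}
    (hL : L.Regular T C) {h : ℝ} {p : ℕ → X} {r : ℕ → F} {V κ : ℝ} {i j : ℕ}
    (hi : (i : ℝ) * h ∈ Icc 0 T) (hj : (j : ℝ) * h ∈ Icc 0 T) (hr : ‖r i‖ ≤ C)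
    (hV : ‖velocity h p j‖ ≤ V) (hκ0 : 0 ≤ κ)
    (hκ : ∀ ξ, L.momentum h p r i ξ - L.momentum h p r j ξ ≤ κ * ‖ξ‖) :
    ‖velocity h p i - velocity h p j‖ ≤ C ^ 2 * (κ
      + C ^ 2 * (2 * V + 2 * (1 + C)) * (|i * h - j * h| + ‖p i - p j‖) + C ^ 2 * ‖r i - r j‖) := by
  have hC := hL.nonneg
  have hV0 : 0 ≤ V := (norm_nonneg _).trans hV
  set Δ := |(i : ℝ) * h - j * h| + ‖p i - p j‖ with hΔ
  have hΔ0 : 0 ≤ Δ := by positivity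
  set vi := velocity h p i with hvi
  set vj := velocity h p j with hvj
  set d := vi - vj with hd
  set gi := L.D (i * h) (p i) (r i) + L.c (i * h) (p i) with hgi
  set gj := L.D (j * h) (p j) (r j) + L.c (j * h) (p j) with hgj
  set Bi := L.B (i * h) (p i) with hBi
  set Bj := L.B (j * h) (p j) with hBj
  have ei : L.momentum h p r i d = inner ℝ (Bi vi) (Bi d) + inner ℝ gi (Bi d) := by
    rw [momentum, step, eval, add_assoc, inner_add_left]
  have ej : L.momentum h p r j d = inner ℝ (Bj vj) (Bj d) + inner ℝ gj (Bj d) := by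
    rw [momentum, step, eval, add_assoc, inner_add_left]
  have hBd : ‖Bi d - Bj d‖ ≤ C * Δ * ‖d‖ := hL.norm_B_sub_apply_le hi hj (p i) (p j) d
  have hBv : ‖Bi vj - Bj vj‖ ≤ C * Δ * ‖vj‖ := hL.norm_B_sub_apply_le hi hj (p i) (p j) vj
  have hgg : ‖gi - gj‖ ≤ C * Δ * (1 + ‖r i‖) + C * ‖r i - r j‖ :=
    hL.norm_force_sub_le hi hj (p i) (p j) (r i) (r j)
  have hgi1 : ‖gi‖ ≤ C * (1 + ‖r i‖) := hL.norm_force_le hi (p i) (r i)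
  have hBjd : ‖Bj d‖ ≤ C * ‖d‖ := hL.norm_B_apply_le hj (p j) d
  have hBid : ‖Bi d‖ ≤ C * ‖d‖ := hL.norm_B_apply_le hi (p i) d
  have hBjv : ‖Bj vj‖ ≤ C * ‖vj‖ := hL.norm_B_apply_le hj (p j) vj
  have hc : ‖d‖ ≤ C * ‖Bi d‖ := hL.le_norm_B _ hi (p i) d
  have hmain : ‖Bi d‖ ^ 2 = (L.momentum h p r i d - L.momentum h p r j d)
      - inner ℝ (Bi vj - Bj vj) (Bi d) - inner ℝ (Bj vj) (Bi d - Bj d)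
      - inner ℝ gi (Bi d - Bj d) - inner ℝ (gi - gj) (Bj d) := by
    rw [ei, ej, ← real_inner_self_eq_norm_sq]
    have : inner ℝ (Bi d) (Bi d) = inner ℝ (Bi vi) (Bi d) - inner ℝ (Bi vj) (Bi d) := by
      rw [← inner_sub_left, ← map_sub]
    rw [this]
    simp only [inner_sub_left, inner_sub_right]
    ring
  have b1 : -inner ℝ (Bi vj - Bj vj) (Bi d) ≤ C * Δ * V * (C * ‖d‖) := by
    have := (abs_le.1 (abs_real_inner_le_norm (Bi vj - Bj vj) (Bi d))).1
    have h2 : ‖Bi vj - Bj vj‖ * ‖Bi d‖ ≤ C * Δ * V * (C * ‖d‖) := by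
      gcongr
      exact hBv.trans (by gcongr)
    linarith
  have b2 : -inner ℝ (Bj vj) (Bi d - Bj d) ≤ C * V * (C * Δ * ‖d‖) := by
    have := (abs_le.1 (abs_real_inner_le_norm (Bj vj) (Bi d - Bj d))).1
    have h2 : ‖Bj vj‖ * ‖Bi d - Bj d‖ ≤ C * V * (C * Δ * ‖d‖) := by
      gcongr
      exact hBjv.trans (by gcongr)
    linarith
  have b3 : -inner ℝ gi (Bi d - Bj d) ≤ C * (1 + C) * (C * Δ * ‖d‖) := by
    have := (abs_le.1 (abs_real_inner_le_norm gi (Bi d - Bj d))).1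
    have h2 : ‖gi‖ * ‖Bi d - Bj d‖ ≤ C * (1 + C) * (C * Δ * ‖d‖) := by
      gcongr
      exact hgi1.trans (by gcongr)
    linarith
  have b4 : -inner ℝ (gi - gj) (Bj d) ≤ (C * Δ * (1 + C) + C * ‖r i - r j‖) * (C * ‖d‖) := by
    have := (abs_le.1 (abs_real_inner_le_norm (gi - gj) (Bj d))).1
    have h2 : ‖gi - gj‖ * ‖Bj d‖ ≤ (C * Δ * (1 + C) + C * ‖r i - r j‖) * (C * ‖d‖) := by
      gcongr
      exact hgg.trans (by gcongr)
    linarith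
  have b0 := hκ d
  set Q := κ + C ^ 2 * (2 * V + 2 * (1 + C)) * Δ + C ^ 2 * ‖r i - r j‖ with hQ
  have hsq : ‖Bi d‖ ^ 2 ≤ Q * ‖d‖ := by
    rw [hmain, hQ]
    linarith
  have hd2 : ‖d‖ * ‖d‖ ≤ C ^ 2 * Q * ‖d‖ := by
    calc ‖d‖ * ‖d‖ ≤ (C * ‖Bi d‖) * (C * ‖Bi d‖) := by gcongr
      _ = C ^ 2 * ‖Bi d‖ ^ 2 := by ring
      _ ≤ C ^ 2 * (Q * ‖d‖) := by gcongr
      _ = _ := by ring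
  rcases (norm_nonneg d).eq_or_lt with h0 | hpos
  · rw [← h0]
    positivity
  · exact le_of_mul_le_mul_right hd2 hpos

/-- The velocities of minimal discrete paths are bounded and equicontinuous, uniformly in the step
size. -/
theorem Regular.exists_velocity_bound {L : Residual X F H} {T C : ℝ} (hL : L.Regular T C)
    (hT : 0 < T) :
    ∃ V : ℝ, 0 ≤ V ∧ ∀ (h : ℝ) (N : ℕ) (p : ℕ → X) (r : ℕ → F), 0 < h → N * h = T →
      (∀ j < N, ‖r j‖ ≤ C) → L.IsMinimal h N p r →
      (∀ j < N, ‖velocity h p j‖ ≤ V) ∧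
      ∀ i < N, ∀ j < N, ‖velocity h p i - velocity h p j‖
        ≤ V * (|i * h - j * h| + ‖r i - r j‖) := by
  have hC := hL.nonneg
  -- `K₁` bounds the total impulse, hence the momentum; `V₁` is the resulting velocity bound; `K₂`
  -- then bounds each impulse, hence the Lipschitz constant of the momentum; `V₂` is the resulting
  -- modulus for the velocity.
  set K₁ := C * (1 + 3 * C) * (T + T * (C * (1 + C)) ^ 2) with hK₁
  have hK₁0 : 0 ≤ K₁ := by positivity
  set V₁ := C * (K₁ * C + C * (1 + C)) with hV₁
  have hV₁0 : 0 ≤ V₁ := by positivity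
  set K₂ := C * (C * (1 + V₁ + C)) * (1 + V₁ + C) with hK₂
  have hK₂0 : 0 ≤ K₂ := by positivity
  set V₂ := C ^ 2 * (K₂ + C ^ 2 * (2 * V₁ + 2 * (1 + C)) * (1 + V₁) + C ^ 2) with hV₂
  have hV₂0 : 0 ≤ V₂ := by positivity
  refine ⟨V₁ + V₂, by positivity, fun h N p r hh hN hr hp => ?_⟩
  -- The constant path is a competitor; its action is bounded independently of the starting point
  -- and of `h`.
  have hact : L.action h N p r ≤ T * (C * (1 + C)) ^ 2 :=
    (hp (fun _ => p 0) rfl).trans (hL.action_const_le hh hN hr (p 0))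
  have hmom : ∀ j < N, ∀ ξ, L.momentum h p r j ξ ≤ K₁ * ‖ξ‖ := by
    intro j hj ξ
    have h1 := hL.neg_momentum_le hh hN hp hj (-ξ)
    rw [momentum_neg, neg_neg, norm_neg] at h1
    refine h1.trans (mul_le_mul_of_nonneg_right ?_ (norm_nonneg _))
    exact (hL.sum_impulse_le hh hN p hr).trans (by rw [hK₁]; gcongr)
  have hV : ∀ j < N, ‖velocity h p j‖ ≤ V₁ := fun j hj =>
    hL.norm_velocity_le_of_momentum hK₁0 (grid_mem_Icc hh hN hj.le) (hr j hj) (hmom j hj)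
  have hI : ∀ j < N, L.impulse C h p r j ≤ K₂ := by
    intro j hj
    have h1 := hL.norm_eval_le (grid_mem_Icc hh hN hj.le) (p j) (velocity h p j) (r j)
    have h2 := hV j hj
    have h3 := hr j hj
    have h4 : ‖L.step h p r j‖ ≤ C * (1 + V₁ + C) := h1.trans (by gcongr)
    rw [impulse, hK₂]
    gcongr
  refine ⟨fun j hj => (hV j hj).trans (by linarith), fun i hi j hj => ?_⟩
  have hκ : ∀ ξ, L.momentum h p r i ξ - L.momentum h p r j ξ
      ≤ K₂ * |i * h - j * h| * ‖ξ‖ := by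
    intro ξ
    rcases le_total j i with hji | hij
    · refine (hL.momentum_sub_le hh hN hp hI hji hi ξ).trans (le_of_eq ?_)
      have : (j : ℝ) ≤ i := by exact_mod_cast hji
      rw [← sub_mul, abs_of_nonneg (mul_nonneg (by linarith) hh.le)]
    · have h1 := hL.momentum_sub_le hh hN hp hI hij hj (-ξ)
      rw [momentum_neg, momentum_neg, norm_neg] at h1
      have : (i : ℝ) ≤ j := by exact_mod_cast hij
      rw [abs_sub_comm, ← sub_mul, abs_of_nonneg (mul_nonneg (by linarith) hh.le)]
      linarith
  have h1 := hL.norm_velocity_sub_le_of_momentum (grid_mem_Icc hh hN hi.le)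
    (grid_mem_Icc hh hN hj.le) (hr i hi) (hV j hj) (by positivity) hκ
  have h2 := norm_sub_le_of_norm_velocity_le (i := i) (j := j) hh fun k _ hk =>
    hV k (hk.trans (max_lt hi hj))
  set a := |(i : ℝ) * h - j * h| with ha
  set b := ‖r i - r j‖ with hb
  have ha0 : 0 ≤ a := abs_nonneg _
  have hb0 : 0 ≤ b := norm_nonneg _
  refine h1.trans ?_
  calc _ ≤ C ^ 2 * (K₂ * a + C ^ 2 * (2 * V₁ + 2 * (1 + C)) * (a + V₁ * a) + C ^ 2 * b) := by
        gcongr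
    _ = V₂ * (a + b) - C ^ 2 * (C ^ 2 * a
          + (K₂ + C ^ 2 * (2 * V₁ + 2 * (1 + C)) * (1 + V₁)) * b) := by rw [hV₂]; ring
    _ ≤ V₂ * (a + b) := by
        have : 0 ≤ C ^ 2 * (C ^ 2 * a
          + (K₂ + C ^ 2 * (2 * V₁ + 2 * (1 + C)) * (1 + V₁)) * b) := by positivity
        linarith
    _ ≤ (V₁ + V₂) * (a + b) := by
        have : 0 ≤ V₁ * (a + b) := by positivity
        linarith

/-- Coercivity bounds the length of the path by its action; this confines the competitors in
`exists_isMinimal`. -/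
lemma Regular.norm_sub_le_action {L : Residual X F H} {T C : ℝ} (hL : L.Regular T C) {h : ℝ}
    {N : ℕ} (hh : 0 < h) (hN : N * h = T) (q : ℕ → X) (r : ℕ → F) {j : ℕ} (hj : j ≤ N) :
    ‖q j - q 0‖ ≤ C * (2 * T + L.action h N q r) := by
  have hC := hL.nonneg
  rw [← sum_Ico_smul_velocity hh.ne' q (Nat.zero_le j), Nat.Ico_zero_eq_range]
  have h1 : ∀ k ∈ Finset.range N, ‖h • velocity h q k‖
      ≤ C * (2 * h + h * ‖L.step h q r k‖ ^ 2) := by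
    intro k hk
    have hk := Finset.mem_range.1 hk
    have h2 := hL.le_norm_eval _ (grid_mem_Icc hh hN hk.le) (q k) (velocity h q k) (r k)
    change _ ≤ C * (‖L.step h q r k‖ + 1) at h2
    have h3 : ‖L.step h q r k‖ + 1 ≤ 2 + ‖L.step h q r k‖ ^ 2 := by
      nlinarith [sq_nonneg (‖L.step h q r k‖ - 1)]
    rw [norm_smul, Real.norm_eq_abs, abs_of_pos hh]
    calc h * ‖velocity h q k‖ ≤ h * (C * (2 + ‖L.step h q r k‖ ^ 2)) := by
          gcongr
          exact h2.trans (by gcongr)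
      _ = _ := by ring
  calc ‖∑ k ∈ Finset.range j, h • velocity h q k‖
      ≤ ∑ k ∈ Finset.range j, ‖h • velocity h q k‖ := norm_sum_le _ _
    _ ≤ ∑ k ∈ Finset.range N, ‖h • velocity h q k‖ :=
        Finset.sum_le_sum_of_subset_of_nonneg (Finset.range_mono hj) fun _ _ _ => norm_nonneg _
    _ ≤ ∑ k ∈ Finset.range N, C * (2 * h + h * ‖L.step h q r k‖ ^ 2) := Finset.sum_le_sum h1
    _ = C * (2 * T + L.action h N q r) := by
        rw [← Finset.mul_sum, Finset.sum_add_distrib, Finset.sum_const, Finset.card_range,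
          nsmul_eq_mul, action, ← hN]
        ring

lemma continuous_of_norm_sub_le_mul {Y Z : Type*} [NormedAddCommGroup Y] [NormedAddCommGroup Z]
    {f : Y → Z} {C : ℝ} (hf : ∀ x x', ‖f x - f x'‖ ≤ C * ‖x - x'‖) : Continuous f := by
  have : LipschitzWith C.toNNReal f := LipschitzWith.of_dist_le_mul fun x x' => by
    rw [dist_eq_norm, dist_eq_norm]
    exact (hf x x').trans (mul_le_mul_of_nonneg_right (Real.le_coe_toNNReal C) (norm_nonneg _))
  exact this.continuous

lemma Regular.continuous_action {L : Residual X F H} {T C : ℝ} (hL : L.Regular T C) {h : ℝ}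
    {N : ℕ} (hh : 0 < h) (hN : N * h = T) (r : ℕ → F) :
    Continuous fun p : ℕ → X => L.action h N p r := by
  refine continuous_finsetSum _ fun j hj => ?_
  have ht := grid_mem_Icc hh hN (Finset.mem_range.1 hj).le
  have hB : Continuous (L.B (j * h)) := continuous_of_norm_sub_le_mul (C := C) fun x x' => by
    simpa using hL.lip_B _ ht _ ht x x'
  have hD : Continuous (L.D (j * h)) := continuous_of_norm_sub_le_mul (C := C) fun x x' => by
    simpa using hL.lip_D _ ht _ ht x x'
  have hc : Continuous (L.c (j * h)) := continuous_of_norm_sub_le_mul (C := C) fun x x' => by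
    simpa using hL.lip_c _ ht _ ht x x'
  have hv : Continuous fun p : ℕ → X => velocity h p j := by unfold velocity; fun_prop
  unfold step eval
  refine continuous_const.mul (Continuous.pow (Continuous.norm ?_) 2)
  exact (((hB.comp (continuous_apply j)).clm_apply hv).add
    ((hD.comp (continuous_apply j)).clm_apply continuous_const)).add (hc.comp (continuous_apply j))

/-- Minimal discrete paths exist for each starting point. -/
theorem Regular.exists_isMinimal [ProperSpace X] {L : Residual X F H} {T C : ℝ}
    (hL : L.Regular T C) {h : ℝ} {N : ℕ} (hh : 0 < h) (hN : N * h = T) (r : ℕ → F) (x₀ : X) :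
    ∃ p : ℕ → X, p 0 = x₀ ∧ L.IsMinimal h N p r := by
  have hC := hL.nonneg
  set R := C * (2 * T + L.action h N (fun _ => x₀) r) with hR
  -- Compact by Tychonoff. All coordinates are confined, including those beyond `N`, which the
  -- action does not see.
  set S : Set (ℕ → X) := univ.pi (fun _ => Metric.closedBall x₀ R) ∩ {p | p 0 = x₀} with hS
  have hcomp : IsCompact S :=
    (isCompact_univ_pi fun _ => isCompact_closedBall x₀ R).inter_right
      (isClosed_eq (continuous_apply 0) continuous_const)
  have hT : 0 ≤ T := hN ▸ by positivity
  have hR0 : 0 ≤ R := by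
    have := L.action_nonneg hh.le N (fun _ => x₀) r
    positivity
  have hconst : (fun _ => x₀) ∈ S :=
    ⟨fun _ _ => Metric.mem_closedBall_self hR0, rfl⟩
  obtain ⟨p, hpS, hpmin⟩ := hcomp.exists_isMinOn ⟨_, hconst⟩
    (hL.continuous_action hh hN r).continuousOn
  refine ⟨p, hpS.2, fun q hq => ?_⟩
  have hq0 : q 0 = x₀ := hq.trans hpS.2
  rcases le_total (L.action h N (fun _ => x₀) r) (L.action h N q r) with hle | hle
  · exact (hpmin hconst).trans hle
  -- Freezing the competitor after index `N` keeps its action and brings it into `S`.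
  · have e : L.action h N q r = L.action h N (fun j => q (min j N)) r :=
      L.action_congr r fun j hj => by rw [min_eq_left hj]
    rw [e]
    refine hpmin ⟨fun j _ => ?_, by simpa using hq0⟩
    rw [mem_closedBall_iff_norm, ← hq0]
    exact (hL.norm_sub_le_action hh hN q r (min_le_right j N)).trans (by rw [hR]; gcongr)

end Residual

end DiscreteEstimates

/-! ### Convergence of discrete actions to the continuous action. -/

section Asymptotics

variable {X F H : Type*} [NormedAddCommGroup X] [NormedSpace ℝ X] [NormedAddCommGroup F]
  [NormedSpace ℝ F] [NormedAddCommGroup H] [InnerProductSpace ℝ H]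

lemma norm_velocity_grid_le {T C h : ℝ} {N : ℕ} {y : ℝ → F} (hy : ContDiffOn ℝ 1 y (Icc 0 T))
    (hyC : ∀ t ∈ Icc 0 T, ‖derivWithin y (Icc 0 T) t‖ ≤ C) (hh : 0 < h) (hN : N * h = T) {j : ℕ}
    (hj : j < N) : ‖velocity h (fun k => y (k * h)) j‖ ≤ C := by
  have := Convex.norm_image_sub_le_of_norm_hasDerivWithin_le (𝕜 := ℝ)
    (fun t ht => hasDerivWithinAt_Icc hy ht) hyC (convex_Icc 0 T)
    (grid_mem_Icc hh hN hj.le) (grid_mem_Icc hh hN hj)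
  have e : (((j + 1 : ℕ) : ℝ) * h - j * h) = h := by push_cast; ring
  rw [e, Real.norm_eq_abs, abs_of_pos hh] at this
  rw [velocity, norm_smul, norm_inv, Real.norm_eq_abs, abs_of_pos hh, inv_mul_le_iff₀ hh]
  linarith

lemma abs_norm_sq_sub_norm_sq_le {G : Type*} [NormedAddCommGroup G] {a b : G} {M ε : ℝ} (ha : ‖a‖ ≤ M) (hb : ‖b‖ ≤ M)
    (hab : ‖a - b‖ ≤ ε) : |‖a‖ ^ 2 - ‖b‖ ^ 2| ≤ ε * (2 * M) := by
  rw [sq_sub_sq, abs_mul, mul_comm, abs_of_nonneg (by positivity : 0 ≤ ‖a‖ + ‖b‖)]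
  have hε : 0 ≤ ε := (norm_nonneg _).trans hab
  gcongr
  · exact (abs_norm_sub_norm_le a b).trans hab
  · linarith

namespace Residual

lemma Regular.continuousOn_eval {L : Residual X F H} {T C : ℝ} (hL : L.Regular T C)
    {x v : ℝ → X} {u : ℝ → F} (hx : ContinuousOn x (Icc 0 T)) (hv : ContinuousOn v (Icc 0 T))
    (hu : ContinuousOn u (Icc 0 T)) :
    ContinuousOn (fun t => L.eval t (x t) (v t) (u t)) (Icc 0 T) := by
  intro t ht
  have hlim : Tendsto (fun t' => C * (|t - t'| + ‖x t - x t'‖) * (1 + ‖v t‖ + ‖u t‖)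
      + C * (‖v t - v t'‖ + ‖u t - u t'‖)) (𝓝[Icc 0 T] t) (𝓝 0) := by
    have h1 : Tendsto (fun t' => C * (|t - t'| + ‖x t - x t'‖) * (1 + ‖v t‖ + ‖u t‖)
      + C * (‖v t - v t'‖ + ‖u t - u t'‖)) (𝓝[Icc 0 T] t)
        (𝓝 (C * (|t - t| + ‖x t - x t‖) * (1 + ‖v t‖ + ‖u t‖)
          + C * (‖v t - v t‖ + ‖u t - u t‖))) := by
      refine Tendsto.add (Tendsto.mul (Tendsto.const_mul _ (Tendsto.add ?_ ?_)) tendsto_const_nhds)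
        (Tendsto.const_mul _ (Tendsto.add ?_ ?_))
      · exact (tendsto_const_nhds.sub (tendsto_id.mono_left nhdsWithin_le_nhds)).abs
      · exact (tendsto_const_nhds.sub (hx t ht)).norm
      · exact (tendsto_const_nhds.sub (hv t ht)).norm
      · exact (tendsto_const_nhds.sub (hu t ht)).norm
    simpa using h1
  refine tendsto_iff_norm_sub_tendsto_zero.2 (squeeze_zero' (.of_forall fun _ => norm_nonneg _)
    ?_ hlim)
  filter_upwards [self_mem_nhdsWithin] with t' ht'
  rw [norm_sub_rev]
  exact hL.norm_eval_sub_le ht ht' _ _ _ _ _ _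

/-- The action of a path with position `x`, velocity `v` and external velocity `u`. -/
def contAction (L : Residual X F H) (T : ℝ) (x v : ℝ → X) (u : ℝ → F) : ℝ :=
  ∫ t in (0 : ℝ)..T, ‖L.eval t (x t) (v t) (u t)‖ ^ 2

/-- The discrete actions converge if positions and velocities converge uniformly. -/
theorem Regular.tendsto_action {L : Residual X F H} {T C : ℝ} (hL : L.Regular T C) (hT : 0 < T)
    {ι : Type*} {l : Filter ι} {h : ι → ℝ} {N : ι → ℕ} (h0 : Tendsto h l (𝓝 0))
    (hN : ∀ᶠ n in l, 0 < h n ∧ N n * h n = T) {y : ℝ → F} (hy : ContDiffOn ℝ 1 y (Icc 0 T))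
    {x : ℝ → X} (hx : ContDiffOn ℝ 1 x (Icc 0 T)) {p : ι → ℕ → X}
    (hp : ∀ ε > 0, ∀ᶠ n in l, ∀ j < N n, ‖p n j - x (j * h n)‖ ≤ ε ∧
      ‖velocity (h n) (p n) j - derivWithin x (Icc 0 T) (j * h n)‖ ≤ ε) :
    Tendsto (fun n => L.action (h n) (N n) (p n) (velocity (h n) fun k => y (k * h n))) l
      (𝓝 (L.contAction T x (derivWithin x (Icc 0 T)) (derivWithin y (Icc 0 T)))) := by
  have hC := hL.nonneg
  have hx' := continuousOn_derivWithin_Icc hT hx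
  have hy' := continuousOn_derivWithin_Icc hT hy
  have hg := hL.continuousOn_eval hx.continuousOn hx' hy'
  set g := fun t => L.eval t (x t) (derivWithin x (Icc 0 T) t) (derivWithin y (Icc 0 T) t)
  obtain ⟨M₁, hM₁0, hM₁⟩ := exists_forall_norm_le_of_continuousOn hx'
  obtain ⟨M₂, hM₂0, hM₂⟩ := exists_forall_norm_le_of_continuousOn hy'
  obtain ⟨G, hG0, hG⟩ := exists_forall_norm_le_of_continuousOn hg
  have hR := tendsto_riemann_sum hT h0 hN (hg.norm.pow 2)
  -- It remains to compare the action with the Riemann sum of the limit integrand.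
  refine (hR.congr_dist ?_ : Tendsto _ _ _)
  rw [Metric.tendsto_nhds]
  intro ε hε
  -- If positions and both velocities are within `η` of their limits, the residuals are within `η *
  -- κ`; `G + κ` bounds both residuals when `η ≤ 1`.
  set κ := C * (1 + M₁ + M₂) + 2 * C with hκ
  have hκ0 : 0 ≤ κ := by positivity
  set A := T * (κ * (2 * (G + κ))) with hA
  have hA0 : 0 ≤ A := by positivity
  obtain ⟨η, hη0, hη1, hηA⟩ : ∃ η : ℝ, 0 < η ∧ η ≤ 1 ∧ η * A < ε := by
    refine ⟨min 1 (ε / (A + 1)), by positivity, min_le_left _ _, ?_⟩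
    have h1 : min 1 (ε / (A + 1)) * (A + 1) ≤ ε := by
      refine (mul_le_mul_of_nonneg_right (min_le_right _ _) (by positivity)).trans (le_of_eq ?_)
      field_simp
    have h2 : 0 < min 1 (ε / (A + 1)) := by positivity
    linarith
  obtain ⟨δ, hδ, hyδ⟩ := exists_forall_norm_velocity_sub_le hT hy hη0
  filter_upwards [hN, h0.eventually (gt_mem_nhds hδ), hp η hη0] with n ⟨hn, hNn⟩ hnδ hpn
  rw [Real.dist_0_eq_abs, abs_of_nonneg dist_nonneg, dist_comm, dist_eq_norm, action,
    ← Finset.sum_sub_distrib]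
  have hterm : ∀ j ∈ Finset.range (N n),
      ‖h n * ‖L.step (h n) (p n) (velocity (h n) fun k => y (k * h n)) j‖ ^ 2
        - h n * ‖g (j * h n)‖ ^ 2‖ ≤ h n * (η * (κ * (2 * (G + κ)))) := by
    intro j hj
    have hj := Finset.mem_range.1 hj
    have ht := grid_mem_Icc hn hNn hj.le
    have h1 := hL.norm_eval_sub_le ht ht (x (j * h n)) (p n j)
      (derivWithin x (Icc 0 T) (j * h n)) (velocity (h n) (p n) j)
      (derivWithin y (Icc 0 T) (j * h n)) (velocity (h n) (fun k => y (k * h n)) j)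
    have h2 := hyδ (h n) (N n) hn hnδ hNn j hj
    obtain ⟨h3, h4⟩ := hpn j hj
    rw [norm_sub_rev] at h2 h3 h4
    have h5 : ‖L.step (h n) (p n) (velocity (h n) fun k => y (k * h n)) j - g (j * h n)‖
        ≤ η * κ := by
      rw [norm_sub_rev]
      refine h1.trans ?_
      rw [sub_self, abs_zero, zero_add]
      have := hM₁ _ ht
      have := hM₂ _ ht
      calc _ ≤ C * η * (1 + M₁ + M₂) + C * (η + η) := by gcongr
        _ = η * κ := by rw [hκ]; ring
    have h6 : ‖L.step (h n) (p n) (velocity (h n) fun k => y (k * h n)) j‖ ≤ G + κ := by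
      have h7 := norm_le_norm_add_norm_sub (g (j * h n))
        (L.step (h n) (p n) (velocity (h n) fun k => y (k * h n)) j)
      rw [norm_sub_rev] at h7
      have h8 := hG _ ht
      have h9 : η * κ ≤ κ := mul_le_of_le_one_left hκ0 hη1
      linarith
    have h7 := abs_norm_sq_sub_norm_sq_le h6 ((hG _ ht).trans (by linarith)) h5
    rw [← mul_sub, norm_mul, Real.norm_eq_abs, abs_of_pos hn, Real.norm_eq_abs, ← mul_assoc η]
    gcongr
  refine (norm_sum_le_of_le _ hterm).trans_lt ?_
  rw [Finset.sum_const, Finset.card_range, nsmul_eq_mul, ← mul_assoc, hNn]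
  calc T * (η * (κ * (2 * (G + κ)))) = η * A := by rw [hA]; ring
    _ < ε := hηA

lemma Regular.tendsto_action_grid {L : Residual X F H} {T C : ℝ} (hL : L.Regular T C)
    (hT : 0 < T) {ι : Type*} {l : Filter ι} {h : ι → ℝ} {N : ι → ℕ} (h0 : Tendsto h l (𝓝 0))
    (hN : ∀ᶠ n in l, 0 < h n ∧ N n * h n = T) {y : ℝ → F} (hy : ContDiffOn ℝ 1 y (Icc 0 T))
    {x : ℝ → X} (hx : ContDiffOn ℝ 1 x (Icc 0 T)) :
    Tendsto (fun n => L.action (h n) (N n) (fun k => x (k * h n))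
      (velocity (h n) fun k => y (k * h n))) l
      (𝓝 (L.contAction T x (derivWithin x (Icc 0 T)) (derivWithin y (Icc 0 T)))) := by
  refine hL.tendsto_action hT h0 hN hy hx fun ε hε => ?_
  obtain ⟨δ, hδ, hδx⟩ := exists_forall_norm_velocity_sub_le hT hx hε
  filter_upwards [hN, h0.eventually (gt_mem_nhds hδ)] with n ⟨hn, hNn⟩ hnδ j hj
  exact ⟨by simpa using hε.le, hδx _ _ hn hnδ hNn j hj⟩

/-- The action depends continuously on a translation of the path. -/
lemma Regular.exists_abs_contAction_add_sub_le {L : Residual X F H} {T C : ℝ}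
    (hL : L.Regular T C) (hT : 0 < T) {x v : ℝ → X} {u : ℝ → F} (hx : ContinuousOn x (Icc 0 T))
    (hv : ContinuousOn v (Icc 0 T)) (hu : ContinuousOn u (Icc 0 T)) :
    ∃ K : ℝ, ∀ a : X, |L.contAction T (fun t => x t + a) v u - L.contAction T x v u|
      ≤ K * ‖a‖ := by
  have hC := hL.nonneg
  obtain ⟨M₁, hM₁0, hM₁⟩ := exists_forall_norm_le_of_continuousOn hv
  obtain ⟨M₂, hM₂0, hM₂⟩ := exists_forall_norm_le_of_continuousOn hu
  refine ⟨C * (1 + M₁ + M₂) * (2 * (C * (1 + M₁ + M₂))) * T, fun a => ?_⟩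
  have hint : ∀ x : ℝ → X, ContinuousOn x (Icc 0 T) → IntervalIntegrable
      (fun t => ‖L.eval t (x t) (v t) (u t)‖ ^ 2) MeasureTheory.volume 0 T := fun x hx => by
    have := (hL.continuousOn_eval hx hv hu).norm.pow 2
    rw [← uIcc_of_le hT.le] at this
    exact this.intervalIntegrable
  rw [contAction, contAction, ← intervalIntegral.integral_sub
    (hint (fun t => x t + a) (hx.add continuousOn_const)) (hint x hx), ← Real.norm_eq_abs]
  have key := intervalIntegral.norm_integral_le_of_norm_le_const (a := 0) (b := T)
    (f := fun t => ‖L.eval t (x t + a) (v t) (u t)‖ ^ 2 - ‖L.eval t (x t) (v t) (u t)‖ ^ 2)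
    (C := C * ‖a‖ * (1 + M₁ + M₂) * (2 * (C * (1 + M₁ + M₂)))) ?_
  · refine key.trans (le_of_eq ?_)
    rw [sub_zero, abs_of_pos hT]; ring
  · intro t ht
    rw [uIoc_of_le hT.le] at ht
    have ht' : t ∈ Icc 0 T := Ioc_subset_Icc_self ht
    have b1 := hM₁ t ht'
    have b2 := hM₂ t ht'
    refine abs_norm_sq_sub_norm_sq_le ?_ ?_ ?_
    · exact (hL.norm_eval_le ht' _ _ _).trans (by gcongr)
    · exact (hL.norm_eval_le ht' _ _ _).trans (by gcongr)
    · refine (hL.norm_eval_sub_le ht' ht' _ _ _ _ _ _).trans ?_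
      simp only [sub_self, abs_zero, add_sub_cancel_left, zero_add, norm_zero, add_zero, mul_zero]
      gcongr

end Residual

end Asymptotics

/-! ### Arzelà–Ascoli for minimal discrete paths, along an ultrafilter. -/

section Compactness

variable {X F H : Type*} [NormedAddCommGroup X] [NormedSpace ℝ X] [NormedAddCommGroup F]
  [NormedSpace ℝ F] [NormedAddCommGroup H] [InnerProductSpace ℝ H]

lemma exists_tendsto_of_eventually_norm_le {Z : Type*} [NormedAddCommGroup Z] [ProperSpace Z]
    {ι : Type*} (l : Ultrafilter ι) {f : ι → Z} {R : ℝ} (hf : ∀ᶠ n in l, ‖f n‖ ≤ R) :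
    ∃ z, Tendsto f l (𝓝 z) := by
  obtain ⟨z, -, hz⟩ := (isCompact_closedBall (0 : Z) R).ultrafilter_le_nhds' (l.map f)
    (hf.mono fun n hn => mem_closedBall_zero_iff.2 hn)
  exact ⟨z, hz⟩

/-- The index of the grid cell containing `t`; the last cell contains its right end point. -/
def cell (h : ℝ) (N : ℕ) (t : ℝ) : ℕ := min ⌊t / h⌋₊ (N - 1)

lemma pos_of_mul_eq {T h : ℝ} {N : ℕ} (hT : 0 < T) (hN : N * h = T) : 0 < N := by
  rcases Nat.eq_zero_or_pos N with h0 | h0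
  · rw [h0, Nat.cast_zero, zero_mul] at hN
    exact absurd hN hT.ne
  · exact h0

lemma cell_lt {T h : ℝ} {N : ℕ} (hT : 0 < T) (hN : N * h = T) (t : ℝ) : cell h N t < N := by
  have := pos_of_mul_eq hT hN
  have h2 : cell h N t ≤ N - 1 := min_le_right _ _
  omega

lemma cell_grid {h : ℝ} {N j : ℕ} (hh : 0 < h) (hj : j < N) : cell h N (j * h) = j := by
  rw [cell, mul_div_cancel_right₀ _ hh.ne', Nat.floor_natCast]
  exact min_eq_left (by omega)

lemma abs_cell_mul_sub_le {T h : ℝ} {N : ℕ} (hT : 0 < T) (hh : 0 < h) (hN : N * h = T) {t : ℝ}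
    (ht : t ∈ Icc 0 T) : |cell h N t * h - t| ≤ h := by
  have hNpos := pos_of_mul_eq hT hN
  have h1 : (⌊t / h⌋₊ : ℝ) * h ≤ t := by
    rw [← le_div_iff₀ hh]
    exact Nat.floor_le (div_nonneg ht.1 hh.le)
  have h2 : t < (⌊t / h⌋₊ + 1) * h := by
    rw [← div_lt_iff₀ hh]
    exact Nat.lt_floor_add_one _
  rw [cell]
  rcases le_total ⌊t / h⌋₊ (N - 1) with hle | hle
  · rw [min_eq_left hle, abs_le]
    constructor <;> linarith
  · rw [min_eq_right hle]
    have h3 : ((N - 1 : ℕ) : ℝ) * h = T - h := by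
      rw [Nat.cast_sub hNpos, ← hN]; push_cast; ring
    have h4 : ((N - 1 : ℕ) : ℝ) * h ≤ ⌊t / h⌋₊ * h := by gcongr
    rw [h3] at h4 ⊢
    rw [abs_le]
    constructor <;> linarith [ht.2]

/-- Discrete first-order Taylor estimate: subtracting the linear path of velocity `velocity h p j`
leaves a sequence with velocities at most `ε` between `i` and `j`. -/
lemma norm_sub_sub_smul_velocity_le {h ε δ : ℝ} {N : ℕ} (hh : 0 < h) {p : ℕ → X} {i j : ℕ}
    (hi : i < N) (hj : j < N) (hij : |(i : ℝ) * h - j * h| < δ)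
    (hmod : ∀ k < N, |(k : ℝ) * h - j * h| < δ → ‖velocity h p k - velocity h p j‖ ≤ ε) :
    ‖p i - p j - (i * h - j * h) • velocity h p j‖ ≤ ε * |i * h - j * h| := by
  have hvel : ∀ k, velocity h (fun k => p k - ((k : ℝ) * h) • velocity h p j) k
      = velocity h p k - velocity h p j := by
    intro k
    have : h⁻¹ • (h • velocity h p j) = velocity h p j := by
      rw [smul_smul, inv_mul_cancel₀ hh.ne', one_smul]
    conv_rhs => rw [← this]
    conv_lhs => rw [velocity]
    conv_rhs => rw [velocity]
    rw [← smul_sub]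
    congr 1
    push_cast
    rw [add_mul, add_smul, one_mul]
    abel
  have key := norm_sub_le_of_norm_velocity_le (V := ε) (i := i) (j := j) hh
    (p := fun k => p k - ((k : ℝ) * h) • velocity h p j) (fun k hk1 hk2 => by
      rw [hvel]
      refine hmod k (hk2.trans (max_lt hi hj)) (lt_of_le_of_lt ?_ hij)
      have hmem : (k : ℝ) * h ∈ uIcc ((j : ℝ) * h) (i * h) := by
        rcases le_total i j with hle | hle
        · rw [min_eq_left hle] at hk1
          rw [max_eq_right hle] at hk2
          rw [uIcc_of_ge (by gcongr)]
          exact ⟨by gcongr, by gcongr⟩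
        · rw [min_eq_right hle] at hk1
          rw [max_eq_left hle] at hk2
          rw [uIcc_of_le (by gcongr)]
          exact ⟨by gcongr, by gcongr⟩
      exact abs_sub_left_of_mem_uIcc hmem)
  convert key using 2
  rw [sub_smul]
  abel

lemma hasDerivWithinAt_of_uniform {S : Set ℝ} {x v : ℝ → X}
    (H : ∀ ε > 0, ∃ δ > 0, ∀ s ∈ S, ∀ t ∈ S, |t - s| < δ →
      ‖x t - x s - (t - s) • v s‖ ≤ ε * |t - s|) {s : ℝ} (hs : s ∈ S) :
    HasDerivWithinAt x (v s) S s := by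
  rw [hasDerivWithinAt_iff_isLittleO, Asymptotics.isLittleO_iff]
  intro ε hε
  obtain ⟨δ, hδ, Hδ⟩ := H ε hε
  filter_upwards [self_mem_nhdsWithin, nhdsWithin_le_nhds (Metric.ball_mem_nhds s hδ)] with t ht htδ
  rw [Metric.mem_ball, Real.dist_eq] at htδ
  exact Hδ s hs t ht htδ

namespace Residual

/-- Minimal discrete paths with bounded starting points converge along an ultrafilter, together
with their velocities, to a `C¹` path. -/
theorem Regular.exists_limit [ProperSpace X] {L : Residual X F H} {T C : ℝ} (hL : L.Regular T C)
    (hT : 0 < T) {y : ℝ → F} (hy : ContDiffOn ℝ 1 y (Icc 0 T))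
    (hyC : ∀ t ∈ Icc 0 T, ‖derivWithin y (Icc 0 T) t‖ ≤ C) {ι : Type*} (l : Ultrafilter ι)
    {h : ι → ℝ} {N : ι → ℕ} (h0 : Tendsto h l (𝓝 0)) (hN : ∀ᶠ n in l, 0 < h n ∧ N n * h n = T)
    {p : ι → ℕ → X} (hp : ∀ᶠ n in l, L.IsMinimal (h n) (N n) (p n)
      (velocity (h n) fun k => y (k * h n))) {R : ℝ} (hR : ∀ᶠ n in l, ‖p n 0‖ ≤ R) :
    ∃ x : ℝ → X, ContDiffOn ℝ 1 x (Icc 0 T) ∧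
      ∀ ε > 0, ∀ᶠ n in l, ∀ j < N n, ‖p n j - x (j * h n)‖ ≤ ε ∧
        ‖velocity (h n) (p n) j - derivWithin x (Icc 0 T) (j * h n)‖ ≤ ε := by
  obtain ⟨V, hV0, hV⟩ := hL.exists_velocity_bound hT
  have hy' := continuousOn_derivWithin_Icc hT hy
  have hbd : ∀ᶠ n in l, ∀ j < N n, ‖velocity (h n) (p n) j‖ ≤ V := by
    filter_upwards [hN, hp] with n ⟨hn, hNn⟩ hpn
    exact (hV _ _ _ _ hn hNn (fun j hj => norm_velocity_grid_le hy hyC hn hNn hj) hpn).1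
  have hmod : ∀ ε > 0, ∃ δ > 0, ∀ᶠ n in l, ∀ i < N n, ∀ j < N n,
      |(i : ℝ) * h n - j * h n| < δ →
        ‖velocity (h n) (p n) i - velocity (h n) (p n) j‖ ≤ ε := by
    intro ε hε
    -- One `ε'` pays for the time increment, three for replacing the difference quotients of `y` by
    -- its derivative at two grid points and comparing these.
    set ε' := ε / (4 * (V + 1)) with hε'
    have hε'0 : 0 < ε' := by positivity
    obtain ⟨δ₁, hδ₁, H₁⟩ := exists_forall_norm_sub_le hy' hε'0
    obtain ⟨δ₂, hδ₂, H₂⟩ := exists_forall_norm_velocity_sub_le hT hy hε'0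
    refine ⟨min δ₁ ε', by positivity, ?_⟩
    filter_upwards [hN, hp, h0.eventually (gt_mem_nhds hδ₂)] with n ⟨hn, hNn⟩ hpn hnδ i hi j hj hij
    have h1 := (hV _ _ _ _ hn hNn (fun j hj => norm_velocity_grid_le hy hyC hn hNn hj) hpn).2
      i hi j hj
    have a1 := H₂ _ _ hn hnδ hNn i hi
    have a2 := H₂ _ _ hn hnδ hNn j hj
    have a3 := H₁ _ (grid_mem_Icc hn hNn hj.le) _ (grid_mem_Icc hn hNn hi.le)
      (hij.trans_le (min_le_left _ _))
    rw [norm_sub_rev] at a2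
    have a4 : ‖velocity (h n) (fun k => y (k * h n)) i - velocity (h n) (fun k => y (k * h n)) j‖
        ≤ 3 * ε' := by
      rw [← dist_eq_norm] at a1 a2 a3 ⊢
      refine (dist_triangle4 _ _ _ _).trans ((add_le_add_three a1 a3 a2).trans (le_of_eq ?_))
      ring
    have a5 : |(i : ℝ) * h n - j * h n| ≤ ε' := (hij.trans_le (min_le_right _ _)).le
    calc _ ≤ V * (ε' + 3 * ε') := h1.trans (by gcongr)
      _ ≤ (V + 1) * (4 * ε') := by nlinarith
      _ = ε := by rw [hε']; field_simp
  -- Positions and velocities extended as step functions; they jump, so they are equicontinuous only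
  -- eventually along `l`.
  set P : ι → ℝ → X := fun n t => p n (cell (h n) (N n) t) with hPdef
  set W : ι → ℝ → X := fun n t => velocity (h n) (p n) (cell (h n) (N n) t) with hWdef
  have hcell : ∀ δ > 0, ∀ᶠ n in l, ∀ s ∈ Icc 0 T, ∀ t ∈ Icc 0 T, |t - s| < δ →
      |cell (h n) (N n) t * h n - cell (h n) (N n) s * h n| < 2 * δ := by
    intro δ hδ
    filter_upwards [hN, h0.eventually (gt_mem_nhds (half_pos hδ))] with n ⟨hn, hNn⟩ hnδ s hs t ht hst
    have b1 := abs_le.1 (abs_cell_mul_sub_le hT hn hNn hs)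
    have b2 := abs_le.1 (abs_cell_mul_sub_le hT hn hNn ht)
    have b3 := abs_lt.1 hst
    rw [abs_lt]
    constructor <;> linarith
  have hPequi : ∀ ε > 0, ∃ δ > 0, ∀ᶠ n in l, ∀ s ∈ Icc 0 T, ∀ t ∈ Icc 0 T, |t - s| < δ →
      ‖P n t - P n s‖ ≤ ε := by
    intro ε hε
    refine ⟨ε / (2 * (V + 1)), by positivity, ?_⟩
    filter_upwards [hN, hbd, hcell (ε / (2 * (V + 1))) (by positivity)]
      with n ⟨hn, hNn⟩ hbn hcn s hs t ht hst
    have b1 := norm_sub_le_of_norm_velocity_le (i := cell (h n) (N n) t)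
      (j := cell (h n) (N n) s) hn fun k _ hk =>
        hbn k (hk.trans (max_lt (cell_lt hT hNn t) (cell_lt hT hNn s)))
    have b2 := (hcn s hs t ht hst).le
    calc _ ≤ V * (2 * (ε / (2 * (V + 1)))) := b1.trans (by gcongr)
      _ ≤ (V + 1) * (2 * (ε / (2 * (V + 1)))) := by gcongr; linarith
      _ = ε := by field_simp
  have hWequi : ∀ ε > 0, ∃ δ > 0, ∀ᶠ n in l, ∀ s ∈ Icc 0 T, ∀ t ∈ Icc 0 T, |t - s| < δ →
      ‖W n t - W n s‖ ≤ ε := by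
    intro ε hε
    obtain ⟨δ, hδ, Hδ⟩ := hmod ε hε
    refine ⟨δ / 2, by positivity, ?_⟩
    filter_upwards [hN, Hδ, hcell (δ / 2) (by positivity)] with n ⟨hn, hNn⟩ hdn hcn s hs t ht hst
    refine hdn _ (cell_lt hT hNn t) _ (cell_lt hT hNn s) ?_
    have := hcn s hs t ht hst
    linarith
  -- Valid for every real `t`, because `cell` always returns an index below `N`.
  have hxlim : ∀ t : ℝ, ∃ z, Tendsto (fun n => P n t) l (𝓝 z) := by
    intro t
    refine exists_tendsto_of_eventually_norm_le l (R := R + V * T) ?_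
    filter_upwards [hN, hbd, hR] with n ⟨hn, hNn⟩ hbn hRn
    have b1 := norm_sub_le_of_norm_velocity_le (i := cell (h n) (N n) t) (j := 0) hn fun k _ hk =>
        hbn k (hk.trans (max_lt (cell_lt hT hNn t) (pos_of_mul_eq hT hNn)))
    have b2 := grid_mem_Icc hn hNn (cell_lt hT hNn t).le
    rw [Nat.cast_zero, zero_mul, sub_zero, abs_of_nonneg b2.1] at b1
    have b3 := mul_le_mul_of_nonneg_left b2.2 hV0
    have b4 := norm_le_norm_add_norm_sub' (p n (cell (h n) (N n) t)) (p n 0)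
    change ‖p n (cell (h n) (N n) t)‖ ≤ _
    linarith
  have hvlim : ∀ t : ℝ, ∃ z, Tendsto (fun n => W n t) l (𝓝 z) := by
    intro t
    refine exists_tendsto_of_eventually_norm_le l (R := V) ?_
    filter_upwards [hN, hbd] with n ⟨hn, hNn⟩ hbn
    exact hbn _ (cell_lt hT hNn t)
  choose x hx using hxlim
  choose v hv using hvlim
  have hctime : ∀ t ∈ Icc 0 T, Tendsto (fun n => (cell (h n) (N n) t : ℝ) * h n) l (𝓝 t) := by
    intro t ht
    refine tendsto_iff_norm_sub_tendsto_zero.2 (squeeze_zero' (.of_forall fun _ => norm_nonneg _)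
      ?_ h0)
    filter_upwards [hN] with n ⟨hn, hNn⟩
    exact abs_cell_mul_sub_le hT hn hNn ht
  -- The discrete Taylor estimate passes to the limit and identifies `v` as the derivative of `x`.
  have hderiv : ∀ ε > 0, ∃ δ > 0, ∀ s ∈ Icc 0 T, ∀ t ∈ Icc 0 T, |t - s| < δ →
      ‖x t - x s - (t - s) • v s‖ ≤ ε * |t - s| := by
    intro ε hε
    obtain ⟨δ, hδ, Hδ⟩ := hmod ε hε
    refine ⟨δ / 2, by positivity, fun s hs t ht hst => ?_⟩
    have hd := (hctime t ht).sub (hctime s hs)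
    refine le_of_tendsto_of_tendsto (((hx t).sub (hx s)).sub (hd.smul (hv s))).norm
      (hd.abs.const_mul ε) ?_
    filter_upwards [hN, Hδ, hcell (δ / 2) (by positivity)] with n ⟨hn, hNn⟩ hdn hcn
    have := hcn s hs t ht hst
    exact norm_sub_sub_smul_velocity_le hn (cell_lt hT hNn t) (cell_lt hT hNn s)
      (by linarith) fun k hk hkδ => hdn k hk _ (cell_lt hT hNn s) hkδ
  have hxd : ∀ s ∈ Icc 0 T, HasDerivWithinAt x (v s) (Icc 0 T) s := fun s hs =>
    hasDerivWithinAt_of_uniform hderiv hs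
  have hdw : ∀ s ∈ Icc 0 T, derivWithin x (Icc 0 T) s = v s := fun s hs =>
    (hxd s hs).derivWithin (uniqueDiffOn_Icc hT s hs)
  have hvc : ContinuousOn v (Icc 0 T) := by
    rw [Metric.continuousOn_iff]
    intro s hs ε hε
    obtain ⟨δ, hδ, Hδ⟩ := hWequi (ε / 2) (by positivity)
    refine ⟨δ, hδ, fun t ht hst => ?_⟩
    rw [Real.dist_eq] at hst
    have : ‖v t - v s‖ ≤ ε / 2 := le_of_tendsto ((hv t).sub (hv s)).norm
      (Hδ.mono fun n hn => hn s hs t ht hst)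
    rw [dist_eq_norm]
    linarith
  refine ⟨x, (contDiffOn_one_iff_derivWithin (uniqueDiffOn_Icc hT)).2
    ⟨fun s hs => (hxd s hs).differentiableWithinAt, hvc.congr hdw⟩, fun ε hε => ?_⟩
  have uP := Metric.tendstoUniformlyOn_iff.1 (tendstoUniformlyOn_of_asymptotically_equicontinuous
    isCompact_Icc hPequi fun t _ => hx t) ε hε
  have uW := Metric.tendstoUniformlyOn_iff.1 (tendstoUniformlyOn_of_asymptotically_equicontinuous
    isCompact_Icc hWequi fun t _ => hv t) ε hε
  filter_upwards [hN, uP, uW] with n ⟨hn, hNn⟩ hPn hWn j hj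
  have hj' := grid_mem_Icc hn hNn hj.le
  have c1 := hPn _ hj'
  have c2 := hWn _ hj'
  rw [dist_comm, dist_eq_norm] at c1 c2
  simp only [hPdef, hWdef, cell_grid hn hj] at c1 c2
  rw [hdw _ hj']
  exact ⟨c1.le, c2.le⟩

end Residual

end Compactness

/-! ### The Euler–Maruyama residual, and discrete paths as sequences. -/

section EulerScheme

variable {m s : ℕ}

/-- The inclusion `ξ ↦ [ξ; 0]`. -/
def stackLeft (m s : ℕ) : EuclideanSpace ℝ (Fin m) →L[ℝ] State m s :=
  LinearMap.toContinuousLinearMap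
    { toFun := fun ξ => stack ξ 0
      map_add' := fun a b => by ext (i | i) <;> simp [stack]
      map_smul' := fun a b => by ext (i | i) <;> simp [stack] }

/-- The inclusion `r ↦ [0; r]`. -/
def stackRight (m s : ℕ) : EuclideanSpace ℝ (Fin s) →L[ℝ] State m s :=
  LinearMap.toContinuousLinearMap
    { toFun := fun r => stack 0 r
      map_add' := fun a b => by ext (i | i) <;> simp [stack]
      map_smul' := fun a b => by ext (i | i) <;> simp [stack] }

lemma stackLeft_apply (x : EuclideanSpace ℝ (Fin m)) : stackLeft m s x = stack x 0 := rfl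

lemma stackRight_apply (y : EuclideanSpace ℝ (Fin s)) : stackRight m s y = stack 0 y := rfl

lemma stackLeft_add_stackRight (x : EuclideanSpace ℝ (Fin m)) (y : EuclideanSpace ℝ (Fin s)) :
    stackLeft m s x + stackRight m s y = stack x y := by
  rw [stackLeft_apply, stackRight_apply]
  ext (i | i) <;> simp [stack]

lemma norm_sq_stack (x : EuclideanSpace ℝ (Fin m)) (y : EuclideanSpace ℝ (Fin s)) :
    ‖stack x y‖ ^ 2 = ‖x‖ ^ 2 + ‖y‖ ^ 2 := by
  simp [EuclideanSpace.norm_sq_eq, stack]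

lemma norm_stackLeft_apply (x : EuclideanSpace ℝ (Fin m)) : ‖stackLeft m s x‖ = ‖x‖ := by
  rw [stackLeft_apply, ← sq_eq_sq₀ (norm_nonneg _) (norm_nonneg _), norm_sq_stack]
  simp

lemma norm_stackRight_apply (y : EuclideanSpace ℝ (Fin s)) : ‖stackRight m s y‖ = ‖y‖ := by
  rw [stackRight_apply, ← sq_eq_sq₀ (norm_nonneg _) (norm_nonneg _), norm_sq_stack]
  simp

lemma norm_le_norm_stack (x : EuclideanSpace ℝ (Fin m)) (y : EuclideanSpace ℝ (Fin s)) :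
    ‖x‖ ≤ ‖stack x y‖ := by
  rw [← sq_le_sq₀ (norm_nonneg _) (norm_nonneg _), norm_sq_stack]
  nlinarith [sq_nonneg ‖y‖]

lemma norm_stackLeft_le : ‖stackLeft m s‖ ≤ 1 :=
  ContinuousLinearMap.opNorm_le_bound _ zero_le_one fun x => by
    rw [norm_stackLeft_apply, one_mul]

lemma norm_stackRight_le : ‖stackRight m s‖ ≤ 1 :=
  ContinuousLinearMap.opNorm_le_bound _ zero_le_one fun x => by
    rw [norm_stackRight_apply, one_mul]

lemma stack_sub_stack (x x' : EuclideanSpace ℝ (Fin m)) (y y' : EuclideanSpace ℝ (Fin s)) :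
    stack x y - stack x' y' = stack (x - x') (y - y') := by
  simp only [← stackLeft_add_stackRight, map_sub]
  abel

lemma smul_stack (a : ℝ) (x : EuclideanSpace ℝ (Fin m)) (y : EuclideanSpace ℝ (Fin s)) :
    a • stack x y = stack (a • x) (a • y) := by
  simp only [← stackLeft_add_stackRight, map_smul, smul_add]

lemma norm_stack_sub_stack_le (x x' : EuclideanSpace ℝ (Fin m)) (y y' : EuclideanSpace ℝ (Fin s)) :
    ‖stack x y - stack x' y'‖ ≤ ‖x - x'‖ + ‖y - y'‖ := by
  rw [stack_sub_stack, ← stackLeft_add_stackRight]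
  refine (norm_add_le _ _).trans (le_of_eq ?_)
  rw [norm_stackLeft_apply, norm_stackRight_apply]

lemma IsC1b.exists_bound {E F : Type*} [NormedAddCommGroup E] [NormedSpace ℝ E]
    [NormedAddCommGroup F] [NormedSpace ℝ F] {T : ℝ} {f : ℝ → E → F} (hf : IsC1b T f) :
    ∃ C : ℝ, 0 ≤ C ∧ (∀ t ∈ Icc 0 T, ∀ z, ‖f t z‖ ≤ C) ∧
      ∀ t ∈ Icc 0 T, ∀ t' ∈ Icc 0 T, ∀ z z',
        ‖f t z - f t' z'‖ ≤ C * (|t - t'| + ‖z - z'‖) := by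
  obtain ⟨hd, C, hC⟩ := hf
  refine ⟨max C 0, le_max_right _ _, fun t ht z =>
    ((hC (t, z) ⟨ht, mem_univ _⟩).1).trans (le_max_left _ _), fun t ht t' ht' z z' => ?_⟩
  have key := Convex.norm_image_sub_le_of_norm_fderivWithin_le (𝕜 := ℝ)
    (hd.differentiableOn one_ne_zero) (fun p hp => (hC p hp).2.trans (le_max_left C 0))
    ((convex_Icc 0 T).prod convex_univ) (x := (t', z')) (y := (t, z)) ⟨ht', mem_univ _⟩
    ⟨ht, mem_univ _⟩
  refine key.trans (mul_le_mul_of_nonneg_left ?_ (le_max_right _ _))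
  rw [Prod.mk_sub_mk, Prod.norm_mk, Real.norm_eq_abs]
  exact max_le (le_add_of_nonneg_right (norm_nonneg _)) (le_add_of_nonneg_left (abs_nonneg _))

/-- The residual `σ⁻¹ ([v; r] - μ)` of the Euler–Maruyama scheme. -/
def residual (σ : ℝ → State m s → (State m s →L[ℝ] State m s)) (μ : ℝ → State m s → State m s)
    (y : ℝ → EuclideanSpace ℝ (Fin s)) :
    Residual (EuclideanSpace ℝ (Fin m)) (EuclideanSpace ℝ (Fin s)) (State m s) where
  B t x := (σ t (stack x (y t))).inverse.comp (stackLeft m s)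
  D t x := (σ t (stack x (y t))).inverse.comp (stackRight m s)
  c t x := -(σ t (stack x (y t))).inverse (μ t (stack x (y t)))

lemma residual_eval (σ : ℝ → State m s → (State m s →L[ℝ] State m s))
    (μ : ℝ → State m s → State m s) (y : ℝ → EuclideanSpace ℝ (Fin s)) (t : ℝ)
    (x v : EuclideanSpace ℝ (Fin m)) (r : EuclideanSpace ℝ (Fin s)) :
    (residual σ μ y).eval t x v r
      = (σ t (stack x (y t))).inverse (stack v r - μ t (stack x (y t))) := by
  rw [Residual.eval, map_sub, ← stackLeft_add_stackRight v r, map_add, sub_eq_add_neg]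
  rfl

/-- The observed path is absorbed into the time dependence of the coefficients, which stay Lipschitz
in time because `y` is. Coercivity comes from the boundedness of `σ`. -/
lemma exists_regular_residual {T : ℝ} (hT : 0 < T)
    {σ : ℝ → State m s → (State m s →L[ℝ] State m s)} {μ : ℝ → State m s → State m s}
    {y : ℝ → EuclideanSpace ℝ (Fin s)} (hσinv : ∀ t ∈ Icc 0 T, ∀ z, (σ t z).IsInvertible)
    (hσ : IsC1b T σ) (hσ' : IsC1b T (fun t z => (σ t z).inverse)) (hμ : IsC1b T μ)
    (hy : ContDiffOn ℝ 1 y (Icc 0 T)) :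
    ∃ C : ℝ, (residual σ μ y).Regular T C ∧
      ∀ t ∈ Icc 0 T, ‖derivWithin y (Icc 0 T) t‖ ≤ C := by
  obtain ⟨a, ha0, ha, hal⟩ := hσ'.exists_bound
  obtain ⟨b, hb0, hb, hbl⟩ := hμ.exists_bound
  obtain ⟨c, hc0, hc, -⟩ := hσ.exists_bound
  obtain ⟨q, hq0, hq⟩ := exists_forall_norm_le_of_continuousOn (continuousOn_derivWithin_Icc hT hy)
  have hylip : ∀ t ∈ Icc 0 T, ∀ t' ∈ Icc 0 T, ‖y t - y t'‖ ≤ q * |t - t'| :=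
    fun t ht t' ht' => Convex.norm_image_sub_le_of_norm_hasDerivWithin_le (𝕜 := ℝ)
      (fun t ht => hasDerivWithinAt_Icc hy ht) hq (convex_Icc 0 T) ht' ht
  have hz : ∀ t ∈ Icc 0 T, ∀ t' ∈ Icc 0 T, ∀ x x' : EuclideanSpace ℝ (Fin m),
      |t - t'| + ‖stack x (y t) - stack x' (y t')‖ ≤ (1 + q) * (|t - t'| + ‖x - x'‖) := by
    intro t ht t' ht' x x'
    have h1 := norm_stack_sub_stack_le x x' (y t) (y t')
    have h2 := hylip t ht t' ht'
    have h3 : 0 ≤ q * ‖x - x'‖ := by positivity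
    linarith
  have hA : ∀ t ∈ Icc 0 T, ∀ t' ∈ Icc 0 T, ∀ x x' : EuclideanSpace ℝ (Fin m),
      ‖(σ t (stack x (y t))).inverse - (σ t' (stack x' (y t'))).inverse‖
        ≤ a * (1 + q) * (|t - t'| + ‖x - x'‖) := fun t ht t' ht' x x' => by
    rw [mul_assoc]
    exact (hal t ht t' ht' _ _).trans (mul_le_mul_of_nonneg_left (hz t ht t' ht' x x') ha0)
  have hM : ∀ t ∈ Icc 0 T, ∀ t' ∈ Icc 0 T, ∀ x x' : EuclideanSpace ℝ (Fin m),
      ‖μ t (stack x (y t)) - μ t' (stack x' (y t'))‖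
        ≤ b * (1 + q) * (|t - t'| + ‖x - x'‖) := fun t ht t' ht' x x' => by
    rw [mul_assoc]
    exact (hbl t ht t' ht' _ _).trans (mul_le_mul_of_nonneg_left (hz t ht t' ht' x x') hb0)
  have hrec : ∀ t ∈ Icc 0 T, ∀ z w, ‖w‖ ≤ c * ‖(σ t z).inverse w‖ := fun t ht z w => by
    conv_lhs => rw [← (hσinv t ht z).self_apply_inverse w]
    exact (σ t z).le_of_opNorm_le (hc t ht z) _
  -- The nonlinear monomials in the expansion of `C`, needed nonnegative when `linarith` compares
  -- each constant with `C`.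
  have h₁ : 0 ≤ a * q := by positivity
  have h₂ : 0 ≤ a * b := by positivity
  have h₃ : 0 ≤ a * b * q := by positivity
  set C := 1 + q + c + b + a * (1 + q) + 2 * (a * b * (1 + q)) with hC
  have hle : ∀ {d D : ℝ} {A : State m s →L[ℝ] State m s}, ‖A‖ ≤ d → d ≤ D →
      ‖A.comp (stackLeft m s)‖ ≤ D ∧ ‖A.comp (stackRight m s)‖ ≤ D := by
    intro d D A h1 h2
    constructor
    · refine (ContinuousLinearMap.opNorm_comp_le _ _).trans ((mul_le_of_le_one_right (norm_nonneg _)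
        norm_stackLeft_le).trans (h1.trans h2))
    · refine (ContinuousLinearMap.opNorm_comp_le _ _).trans ((mul_le_of_le_one_right (norm_nonneg _)
        norm_stackRight_le).trans (h1.trans h2))
  have haC : a * (1 + q) ≤ C := by linarith
  refine ⟨C, ⟨by linarith, fun t ht x => (hle (ha t ht _) (by linarith)).1,
    fun t ht x => (hle (ha t ht _) (by linarith)).2, fun t ht x => ?_, fun t ht t' ht' x x' => ?_,
    fun t ht t' ht' x x' => ?_, fun t ht t' ht' x x' => ?_, fun t ht x v => ?_,
    fun t ht x v r => ?_⟩, fun t ht => (hq t ht).trans (by linarith)⟩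
  · change ‖-_‖ ≤ _
    rw [norm_neg]
    refine (ContinuousLinearMap.le_of_opNorm_le _ (ha t ht _) _).trans ?_
    exact (mul_le_mul_of_nonneg_left (hb t ht _) ha0).trans (by linarith)
  · have := (hle (hA t ht t' ht' x x') (mul_le_mul_of_nonneg_right haC (by positivity))).1
    rwa [ContinuousLinearMap.sub_comp] at this
  · have := (hle (hA t ht t' ht' x x') (mul_le_mul_of_nonneg_right haC (by positivity))).2
    rwa [ContinuousLinearMap.sub_comp] at this
  · change ‖-_ - -_‖ ≤ _
    set A := (σ t (stack x (y t))).inverse with hAdef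
    set A' := (σ t' (stack x' (y t'))).inverse with hAdef'
    set w := μ t (stack x (y t)) with hw
    set w' := μ t' (stack x' (y t')) with hw'
    set Δ := |t - t'| + ‖x - x'‖ with hΔ
    have hΔ0 : 0 ≤ Δ := by positivity
    have e : -A w - -A' w' = -((A - A') w + A' (w - w')) := by
      rw [map_sub, sub_apply]; abel
    rw [e, norm_neg]
    have b1 := (A - A').le_of_opNorm_le (hA t ht t' ht' x x') w
    have b2 := A'.le_of_opNorm_le (ha t' ht' _) (w - w')
    have b3 : ‖w‖ ≤ b := hb t ht _
    have b4 : ‖w - w'‖ ≤ b * (1 + q) * Δ := hM t ht t' ht' x x'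
    calc ‖(A - A') w + A' (w - w')‖ ≤ a * (1 + q) * Δ * b + a * (b * (1 + q) * Δ) :=
          (norm_add_le _ _).trans (add_le_add (b1.trans (by gcongr)) (b2.trans (by gcongr)))
      _ = 2 * (a * b * (1 + q)) * Δ := by ring
      _ ≤ C * Δ := by
          gcongr
          have : 0 ≤ a * (1 + q) := by positivity
          linarith
  · have h1 := hrec t ht (stack x (y t)) (stackLeft m s v)
    rw [norm_stackLeft_apply] at h1
    refine h1.trans (mul_le_mul_of_nonneg_right ?_ (norm_nonneg _))
    linarith
  · rw [residual_eval]
    have h1 := hrec t ht (stack x (y t)) (stack v r - μ t (stack x (y t)))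
    set w := (σ t (stack x (y t))).inverse (stack v r - μ t (stack x (y t)))
    -- `v` is a block of `[v; r]`, so the coercivity bound does not involve `r`.
    have h2 := norm_le_norm_stack v r
    have h3 := norm_le_norm_sub_add (stack v r) (μ t (stack x (y t)))
    have h4 := hb t ht (stack x (y t))
    have h5 : c * ‖w‖ ≤ C * ‖w‖ := mul_le_mul_of_nonneg_right (by linarith) (norm_nonneg _)
    linarith

lemma DiscretePath.val_of_le {T : ℝ} {n : ℕ} (x : DiscretePath m T n) {j : ℕ}
    (hj : j ≤ numSteps T n) : x.val j = x ⟨j, Nat.lt_succ_of_le hj⟩ := by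
  simp only [DiscretePath.val, min_eq_left hj]

/-- The discrete path through the first points of a sequence. -/
def DiscretePath.ofSeq (T : ℝ) (n : ℕ) (p : ℕ → EuclideanSpace ℝ (Fin m)) : DiscretePath m T n :=
  fun i => p i

lemma DiscretePath.val_ofSeq {T : ℝ} {n : ℕ} (p : ℕ → EuclideanSpace ℝ (Fin m)) {j : ℕ}
    (hj : j ≤ numSteps T n) : (DiscretePath.ofSeq T n p).val j = p j := by
  rw [DiscretePath.val_of_le _ hj, DiscretePath.ofSeq]

/-- The step size `2⁻ⁿ`. -/
def meshSize (n : ℕ) : ℝ := (2 ^ n)⁻¹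

lemma meshSize_pos (n : ℕ) : 0 < meshSize n := by rw [meshSize]; positivity

lemma tendsto_meshSize : Tendsto meshSize atTop (𝓝 0) :=
  tendsto_inv_atTop_zero.comp (tendsto_pow_atTop_atTop_of_one_lt one_lt_two)

lemma numSteps_mul_meshSize {T : ℝ} {ν K : ℕ} (hTK : T * 2 ^ ν = K) {n : ℕ} (hn : ν ≤ n) :
    numSteps T n * meshSize n = T := by
  obtain ⟨k, rfl⟩ := Nat.exists_eq_add_of_le hn
  have h1 : T * 2 ^ (ν + k) = ((K * 2 ^ k : ℕ) : ℝ) := by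
    rw [pow_add, ← mul_assoc, hTK]; push_cast; ring
  rw [numSteps, h1, Nat.floor_natCast, ← h1, meshSize, mul_assoc,
    mul_inv_cancel₀ (by positivity), mul_one]

lemma discreteLogLik_eq (T : ℝ) (σ : ℝ → State m s → (State m s →L[ℝ] State m s))
    (μ : ℝ → State m s → State m s) (φ : EuclideanSpace ℝ (Fin m) → ℝ)
    (y : ℝ → EuclideanSpace ℝ (Fin s)) (n : ℕ) (x : DiscretePath m T n) :
    discreteLogLik T σ μ φ y n x = -(1 / 2) * (residual σ μ y).action (meshSize n) (numSteps T n)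
      x.val (velocity (meshSize n) fun k => y (k * meshSize n)) - φ (x.val 0) := by
  rw [discreteLogLik, Residual.action, Finset.sum_range]
  congr 2
  refine Finset.sum_congr rfl fun j _ => ?_
  have e1 : x.val j = x j.castSucc := DiscretePath.val_of_le x j.2.le
  have e2 : x.val (j + 1) = x j.succ := DiscretePath.val_of_le x j.2
  have e3 : ((j : ℕ) : ℝ) * meshSize n + meshSize n = ((j + 1 : ℕ) : ℝ) * meshSize n := by
    push_cast; ring
  rw [Residual.step, residual_eval, velocity, velocity, e1, e2, ← e3, ← smul_stack,
    ← stack_sub_stack]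
  rfl

lemma discreteLogLik_ofSeq (T : ℝ) (σ : ℝ → State m s → (State m s →L[ℝ] State m s))
    (μ : ℝ → State m s → State m s) (φ : EuclideanSpace ℝ (Fin m) → ℝ)
    (y : ℝ → EuclideanSpace ℝ (Fin s)) (n : ℕ) (p : ℕ → EuclideanSpace ℝ (Fin m)) :
    discreteLogLik T σ μ φ y n (DiscretePath.ofSeq T n p)
      = -(1 / 2) * (residual σ μ y).action (meshSize n) (numSteps T n) p
        (velocity (meshSize n) fun k => y (k * meshSize n)) - φ (p 0) := by
  rw [discreteLogLik_eq, DiscretePath.val_ofSeq p (Nat.zero_le _),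
    Residual.action_congr _ _ fun j hj => DiscretePath.val_ofSeq p hj]

lemma contLogLik_eq {T : ℝ} (hT : 0 < T) (σ : ℝ → State m s → (State m s →L[ℝ] State m s))
    (μ : ℝ → State m s → State m s) (φ : EuclideanSpace ℝ (Fin m) → ℝ)
    {y : ℝ → EuclideanSpace ℝ (Fin s)} (hy : ContDiffOn ℝ 1 y (Icc 0 T))
    {x : ℝ → EuclideanSpace ℝ (Fin m)} (hx : ContDiffOn ℝ 1 x (Icc 0 T)) :
    contLogLik T σ μ φ y x = -(1 / 2) * (residual σ μ y).contAction T x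
      (derivWithin x (Icc 0 T)) (derivWithin y (Icc 0 T)) - φ (x 0) := by
  rw [contLogLik, Residual.contAction]
  congr 2
  refine intervalIntegral.integral_congr fun t ht => ?_
  rw [uIcc_of_le hT.le] at ht
  have hd : HasDerivWithinAt (fun u => stack (x u) (y u))
      (stack (derivWithin x (Icc 0 T) t) (derivWithin y (Icc 0 T) t)) (Icc 0 T) t := by
    simp only [← stackLeft_add_stackRight]
    exact ((stackLeft m s).hasFDerivAt.comp_hasDerivWithinAt t (hasDerivWithinAt_Icc hx ht)).add
      ((stackRight m s).hasFDerivAt.comp_hasDerivWithinAt t (hasDerivWithinAt_Icc hy ht))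
  simp only [residual_eval]
  rw [hd.derivWithin (uniqueDiffOn_Icc hT t ht)]

/-- The interpolation stays close to the grid point of its cell. -/
lemma norm_interp_sub_le {T : ℝ} (hT : 0 < T) {n : ℕ}
    (hN : numSteps T n * meshSize n = T) (x : DiscretePath m T n) {t : ℝ} (ht : t ∈ Icc 0 T) :
    ‖x.interp t - x.val (cell (meshSize n) (numSteps T n) t)‖
      ≤ meshSize n * ‖velocity (meshSize n) x.val (cell (meshSize n) (numSteps T n) t)‖ := by
  have hh := meshSize_pos n
  have hpos := pos_of_mul_eq hT hN
  have hv : ∀ k, meshSize n * ‖velocity (meshSize n) x.val k‖ = ‖x.val (k + 1) - x.val k‖ := by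
    intro k
    rw [← smul_velocity hh.ne' x.val k, norm_smul, Real.norm_eq_abs, abs_of_pos hh]
  have hdiv : t / meshSize n = t * 2 ^ n := by rw [meshSize, div_inv_eq_mul]
  rw [hv, cell, hdiv, DiscretePath.interp]
  set j := ⌊t * 2 ^ n⌋₊ with hj
  rcases lt_or_ge j (numSteps T n) with hlt | hge
  · rw [min_eq_left (by omega), add_sub_cancel_left, norm_smul]
    refine mul_le_of_le_one_left (norm_nonneg _) ?_
    have h1 : (j : ℝ) ≤ t * 2 ^ n := Nat.floor_le (mul_nonneg ht.1 (by positivity))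
    have h2 : t * 2 ^ n < j + 1 := Nat.lt_floor_add_one _
    rw [Real.norm_eq_abs, abs_le]
    constructor <;> linarith
  -- The end point `t = T`: truncation in `val` makes the interpolation equal to the last value,
  -- while the cell is the one before it.
  · have e1 : x.val j = x.val (numSteps T n) := by simp [DiscretePath.val, min_eq_right hge]
    have e2 : x.val (j + 1) = x.val (numSteps T n) := by
      simp [DiscretePath.val, min_eq_right (hge.trans (Nat.le_succ j))]
    rw [e1, e2, min_eq_right (by omega), Nat.sub_add_cancel hpos]
    simp

lemma tendstoUniformlyOn_interp {T : ℝ} (hT : 0 < T) {l : Filter ℕ}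
    (h0 : Tendsto meshSize l (𝓝 0)) (hN : ∀ᶠ n in l, numSteps T n * meshSize n = T)
    {x : ℝ → EuclideanSpace ℝ (Fin m)} (hx : ContDiffOn ℝ 1 x (Icc 0 T))
    {p : (n : ℕ) → DiscretePath m T n}
    (hp : ∀ ε > 0, ∀ᶠ n in l, ∀ j < numSteps T n, ‖(p n).val j - x (j * meshSize n)‖ ≤ ε ∧
      ‖velocity (meshSize n) (p n).val j - derivWithin x (Icc 0 T) (j * meshSize n)‖ ≤ ε) :
    TendstoUniformlyOn (fun n t => (p n).interp t) x l (Icc 0 T) := by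
  rw [Metric.tendstoUniformlyOn_iff]
  intro ε hε
  obtain ⟨M, hM0, hM⟩ := exists_forall_norm_le_of_continuousOn (continuousOn_derivWithin_Icc hT hx)
  obtain ⟨δ, hδ, Hδ⟩ := exists_forall_norm_sub_le hx.continuousOn (by positivity : 0 < ε / 4)
  filter_upwards [hN, hp (ε / 4) (by positivity), hp 1 one_pos, h0.eventually (gt_mem_nhds hδ),
    h0.eventually (gt_mem_nhds (by positivity : 0 < ε / (4 * (M + 1))))]
    with n hNn hpε hp1 hnδ hnε t ht
  have hh := meshSize_pos n
  have hc := cell_lt hT hNn t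
  have hct := grid_mem_Icc hh hNn hc.le
  have h1 := norm_interp_sub_le hT hNn (p n) ht
  have h2 := (hpε _ hc).1
  have h3 := (hp1 _ hc).2
  set k := cell (meshSize n) (numSteps T n) t
  have h4 := Hδ _ ht _ hct ((abs_cell_mul_sub_le hT hh hNn ht).trans_lt hnδ)
  have h5 : ‖velocity (meshSize n) (p n).val k‖ ≤ M + 1 := by
    have := norm_le_norm_add_norm_sub' (velocity (meshSize n) (p n).val k)
      (derivWithin x (Icc 0 T) (k * meshSize n))
    linarith [hM _ hct]
  have h6 : meshSize n * ‖velocity (meshSize n) (p n).val k‖ ≤ ε / 4 := by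
    calc _ ≤ ε / (4 * (M + 1)) * (M + 1) := by gcongr
      _ = ε / 4 := by field_simp
  rw [dist_comm]
  rw [← dist_eq_norm] at h1 h2 h4
  have h7 := dist_triangle4 ((p n).interp t) ((p n).val k) (x (k * meshSize n)) (x t)
  linarith

end EulerScheme

/-! ### Convergence of the infima and of the maximizers. -/

section Convergence

variable {m s : ℕ} {T : ℝ} {σ : ℝ → State m s → (State m s →L[ℝ] State m s)}
  {μ : ℝ → State m s → State m s} {φ : EuclideanSpace ℝ (Fin m) → ℝ}
  {y : ℝ → EuclideanSpace ℝ (Fin s)} {C : ℝ}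

lemma exists_norm_le_of_tendsto_cocompact (hφ : Tendsto φ (cocompact _) atTop) (a : ℝ) :
    ∃ R : ℝ, ∀ x, φ x ≤ a → ‖x‖ ≤ R := by
  obtain ⟨S, hS, hSφ⟩ := mem_cocompact.1 (hφ.eventually_gt_atTop a)
  obtain ⟨R, hR⟩ := hS.isBounded.exists_norm_le
  refine ⟨R, fun x hx => hR x ?_⟩
  by_contra hxS
  exact absurd (hSφ hxS) (not_lt.2 hx)

/-- The discrete log-likelihoods of the restrictions of a `C¹` path to the grids converge. -/
lemma tendsto_discreteLogLik_ofSeq (hT : 0 < T) (hL : (residual σ μ y).Regular T C)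
    (hy : ContDiffOn ℝ 1 y (Icc 0 T)) (hN : ∀ᶠ n in atTop, numSteps T n * meshSize n = T)
    {x : ℝ → EuclideanSpace ℝ (Fin m)} (hx : ContDiffOn ℝ 1 x (Icc 0 T)) :
    Tendsto (fun n => discreteLogLik T σ μ φ y n
      (DiscretePath.ofSeq T n fun k => x (k * meshSize n))) atTop
      (𝓝 (contLogLik T σ μ φ y x)) := by
  simp only [discreteLogLik_ofSeq, Nat.cast_zero, zero_mul]
  rw [contLogLik_eq hT σ μ φ hy hx]
  exact ((hL.tendsto_action_grid hT tendsto_meshSize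
    (hN.mono fun n hn => ⟨meshSize_pos n, hn⟩) hy hx).const_mul _).sub tendsto_const_nhds

/-- A discrete maximizer minimizes the action among the paths with its starting point. -/
lemma isMinimal_of_forall_le {n : ℕ} {x : DiscretePath m T n}
    (hx : ∀ x', discreteLogLik T σ μ φ y n x' ≤ discreteLogLik T σ μ φ y n x) :
    (residual σ μ y).IsMinimal (meshSize n) (numSteps T n) x.val
      (velocity (meshSize n) fun k => y (k * meshSize n)) := by
  intro q hq
  have := hx (DiscretePath.ofSeq T n q)
  rw [discreteLogLik_ofSeq, discreteLogLik_eq, hq] at this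
  linarith

lemma tendsto_zero_of_uniform {l : Filter ℕ} (hT : 0 < T)
    (hN : ∀ᶠ n in l, numSteps T n * meshSize n = T)
    {x v : ℝ → EuclideanSpace ℝ (Fin m)} {p : ℕ → ℕ → EuclideanSpace ℝ (Fin m)}
    (hp : ∀ ε > 0, ∀ᶠ n in l, ∀ j < numSteps T n, ‖p n j - x (j * meshSize n)‖ ≤ ε ∧
      ‖velocity (meshSize n) (p n) j - v (j * meshSize n)‖ ≤ ε) :
    Tendsto (fun n => p n 0) l (𝓝 (x 0)) := by
  rw [Metric.tendsto_nhds]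
  intro ε hε
  filter_upwards [hN, hp (ε / 2) (by positivity)] with n hNn hpn
  have := (hpn 0 (pos_of_mul_eq hT hNn)).1
  rw [Nat.cast_zero, zero_mul] at this
  rw [dist_eq_norm]
  linarith

/-- The lower bound for the discrete infima: minimal discrete paths have a limit, which is then
translated to their starting points. -/
theorem eventually_lt_iInf_discrete (hT : 0 < T) (hL : (residual σ μ y).Regular T C)
    (hy : ContDiffOn ℝ 1 y (Icc 0 T)) (hyC : ∀ t ∈ Icc 0 T, ‖derivWithin y (Icc 0 T) t‖ ≤ C)
    (hN : ∀ᶠ n in atTop, numSteps T n * meshSize n = T) (hφ : Tendsto φ (cocompact _) atTop)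
    {a : EReal} (ha : a < ⨅ x : C1Path m T, ((-contLogLik T σ μ φ y x.1 : ℝ) : EReal)) :
    ∀ᶠ n in atTop, a < ⨅ x : DiscretePath m T n,
      ((-discreteLogLik T σ μ φ y n x : ℝ) : EReal) := by
  rw [Filter.Eventually, mem_iff_ultrafilter]
  intro l hl
  by_contra hnot
  have hle : ∀ᶠ n in l, (⨅ x : DiscretePath m T n,
      ((-discreteLogLik T σ μ φ y n x : ℝ) : EReal)) ≤ a := by
    filter_upwards [Ultrafilter.compl_mem_iff_notMem.2 hnot] with n hn
    exact not_lt.1 hn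
  have hNl := hN.filter_mono hl
  -- Discrete values lie below `b` and all continuous values above `c`; the gap `c - b` absorbs the
  -- approximation errors.
  obtain ⟨b, hab, hb⟩ := EReal.lt_iff_exists_real_btwn.1 ha
  obtain ⟨c, hbc, hc⟩ := EReal.lt_iff_exists_real_btwn.1 hb
  rw [EReal.coe_lt_coe_iff] at hbc
  -- The discrete infimum need not be attained. A path with value below `b` is replaced by a minimal
  -- one with the same starting point, which leaves the `φ` term unchanged.
  have hex : ∀ᶠ n in l, ∃ p : ℕ → EuclideanSpace ℝ (Fin m),
      (residual σ μ y).IsMinimal (meshSize n) (numSteps T n) p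
        (velocity (meshSize n) fun k => y (k * meshSize n)) ∧
      1 / 2 * (residual σ μ y).action (meshSize n) (numSteps T n) p
        (velocity (meshSize n) fun k => y (k * meshSize n)) + φ (p 0) < b := by
    filter_upwards [hNl, hle] with n hNn hn
    obtain ⟨x, hx⟩ := iInf_lt_iff.1 (hn.trans_lt hab)
    rw [EReal.coe_lt_coe_iff, discreteLogLik_eq] at hx
    obtain ⟨p, hp0, hp⟩ := hL.exists_isMinimal (meshSize_pos n) hNn
      (velocity (meshSize n) fun k => y (k * meshSize n)) (x.val 0)
    refine ⟨p, hp, ?_⟩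
    have := hp x.val hp0.symm
    rw [hp0]
    linarith
  obtain ⟨p, hp⟩ := hex.choice
  obtain ⟨R, hR⟩ := exists_norm_le_of_tendsto_cocompact hφ b
  have h0 : Tendsto meshSize l (𝓝 0) := tendsto_meshSize.mono_left hl
  have hN' : ∀ᶠ n in l, 0 < meshSize n ∧ numSteps T n * meshSize n = T :=
    hNl.mono fun n hn => ⟨meshSize_pos n, hn⟩
  obtain ⟨x, hx, hpx⟩ := hL.exists_limit hT hy hyC l h0 hN' (hp.mono fun n hn => hn.1)
    (R := R) (hp.mono fun n hn => hR _ (by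
      have := (residual σ μ y).action_nonneg (meshSize_pos n).le (numSteps T n) (p n)
        (velocity (meshSize n) fun k => y (k * meshSize n))
      linarith [hn.2]))
  have hact := hL.tendsto_action hT h0 hN' hy hx hpx
  have hp0 := tendsto_zero_of_uniform hT hNl hpx
  obtain ⟨K, hK⟩ := hL.exists_abs_contAction_add_sub_le hT hx.continuousOn
    (continuousOn_derivWithin_Icc hT hx) (continuousOn_derivWithin_Icc hT hy)
  set S := (residual σ μ y).contAction T x (derivWithin x (Icc 0 T)) (derivWithin y (Icc 0 T))
  -- Cost of translating the limit path, plus the error in its action.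
  have hgap : Tendsto (fun n => 1 / 2 * (K * ‖p n 0 - x 0‖) + 1 / 2 * (S
      - (residual σ μ y).action (meshSize n) (numSteps T n) (p n)
        (velocity (meshSize n) fun k => y (k * meshSize n)))) l (𝓝 0) := by
    have := (((hp0.sub_const (x 0)).norm.const_mul K).const_mul (1 / 2)).add
      ((hact.const_sub S).const_mul (1 / 2))
    simpa using this
  obtain ⟨n, hn, hgn⟩ := (hp.and (hgap.eventually (gt_mem_nhds (sub_pos.2 hbc)))).exists
  -- The translated path starts at `p n 0`, so no continuity of `φ` is needed to compare the two
  -- values.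
  have hx' : ContDiffOn ℝ 1 (fun t => x t + (p n 0 - x 0)) (Icc 0 T) := hx.add contDiffOn_const
  have h1 := iInf_le (fun x : C1Path m T => ((-contLogLik T σ μ φ y x.1 : ℝ) : EReal)) ⟨_, hx'⟩
  have h2 := hc.trans_le h1
  rw [EReal.coe_lt_coe_iff, contLogLik_eq hT σ μ φ hy hx'] at h2
  have h3 : derivWithin (fun t => x t + (p n 0 - x 0)) (Icc 0 T) = derivWithin x (Icc 0 T) := by
    funext t
    rw [derivWithin_add_const]
  rw [h3, add_sub_cancel] at h2
  have h4 := (abs_le.1 (hK (p n 0 - x 0))).2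
  linarith [hn.2]

theorem tendsto_iInf_discrete (hT : 0 < T) (hL : (residual σ μ y).Regular T C)
    (hy : ContDiffOn ℝ 1 y (Icc 0 T)) (hyC : ∀ t ∈ Icc 0 T, ‖derivWithin y (Icc 0 T) t‖ ≤ C)
    (hN : ∀ᶠ n in atTop, numSteps T n * meshSize n = T) (hφ : Tendsto φ (cocompact _) atTop) :
    Tendsto (fun n : ℕ => ⨅ x : DiscretePath m T n,
        ((-discreteLogLik T σ μ φ y n x : ℝ) : EReal)) atTop
      (𝓝 (⨅ x : C1Path m T, ((-contLogLik T σ μ φ y x.1 : ℝ) : EReal))) := by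
  refine tendsto_order.2 ⟨fun a ha => eventually_lt_iInf_discrete hT hL hy hyC hN hφ ha,
    fun a ha => ?_⟩
  obtain ⟨x, hx⟩ := iInf_lt_iff.1 ha
  have hlim := (continuous_coe_real_ereal.tendsto _).comp
    (tendsto_discreteLogLik_ofSeq (φ := φ) hT hL hy hN x.2).neg
  filter_upwards [hlim.eventually (gt_mem_nhds hx)] with n hn
  exact (iInf_le _ _).trans_lt hn

theorem tendstoUniformlyOn_interp_of_maximizers (hT : 0 < T) (hL : (residual σ μ y).Regular T C)
    (hy : ContDiffOn ℝ 1 y (Icc 0 T)) (hyC : ∀ t ∈ Icc 0 T, ‖derivWithin y (Icc 0 T) t‖ ≤ C)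
    (hN : ∀ᶠ n in atTop, numSteps T n * meshSize n = T) (hφ : Tendsto φ (cocompact _) atTop)
    (hφl : LowerSemicontinuous φ) (xstar : C1Path m T)
    (hmax : ∀ x : C1Path m T, contLogLik T σ μ φ y x.1 ≤ contLogLik T σ μ φ y xstar.1)
    (huniq : ∀ x : C1Path m T, contLogLik T σ μ φ y x.1 = contLogLik T σ μ φ y xstar.1 →
      EqOn x.1 xstar.1 (Icc 0 T)) (xmax : (n : ℕ) → DiscretePath m T n)
    (hxmax : ∀ᶠ n in atTop, ∀ x : DiscretePath m T n,
      discreteLogLik T σ μ φ y n x ≤ discreteLogLik T σ μ φ y n (xmax n)) :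
    TendstoUniformlyOn (fun n t => (xmax n).interp t) xstar.1 atTop (Icc 0 T) := by
  rw [Metric.tendstoUniformlyOn_iff]
  intro ε hε
  rw [Filter.Eventually, mem_iff_ultrafilter]
  intro l hl
  have hNl := hN.filter_mono hl
  have hxl := hxmax.filter_mono hl
  have h0 : Tendsto meshSize l (𝓝 0) := tendsto_meshSize.mono_left hl
  have hN' : ∀ᶠ n in l, 0 < meshSize n ∧ numSteps T n * meshSize n = T :=
    hNl.mono fun n hn => ⟨meshSize_pos n, hn⟩
  have hstar := (tendsto_discreteLogLik_ofSeq (φ := φ) hT hL hy hN xstar.2).mono_left hl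
  set Λ := contLogLik T σ μ φ y xstar.1
  -- Compare the maximizer with the restriction of `x*` to the grid.
  have hlow : ∀ δ > 0, ∀ᶠ n in l,
      1 / 2 * (residual σ μ y).action (meshSize n) (numSteps T n) (xmax n).val
        (velocity (meshSize n) fun k => y (k * meshSize n)) + φ ((xmax n).val 0) ≤ -Λ + δ := by
    intro δ hδ
    filter_upwards [hxl, hstar.eventually (lt_mem_nhds (sub_lt_self Λ hδ))] with n hn hsn
    have := hn (DiscretePath.ofSeq T n fun k => xstar.1 (k * meshSize n))
    rw [discreteLogLik_eq T σ μ φ y n (xmax n)] at this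
    linarith
  obtain ⟨R, hR⟩ := exists_norm_le_of_tendsto_cocompact hφ (-Λ + 1)
  obtain ⟨x, hx, hpx⟩ := hL.exists_limit hT hy hyC l h0 hN'
    (hxl.mono fun n hn => isMinimal_of_forall_le hn) (R := R)
    ((hlow 1 one_pos).mono fun n hn => hR _ (by
      have := (residual σ μ y).action_nonneg (meshSize_pos n).le (numSteps T n) (xmax n).val
        (velocity (meshSize n) fun k => y (k * meshSize n))
      linarith))
  have hact := hL.tendsto_action hT h0 hN' hy hx hpx
  have hp0 := tendsto_zero_of_uniform hT hNl hpx
  have hge : Λ ≤ contLogLik T σ μ φ y x := by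
    rw [contLogLik_eq hT σ μ φ hy hx]
    refine le_of_forall_pos_le_add fun δ hδ => ?_
    have e1 := hlow (δ / 3) (by positivity)
    -- Lower semicontinuity of `φ` at the limiting starting point: in the limit `φ` cannot jump up.
    have e2 := hp0.eventually (hφl (x 0) (φ (x 0) - δ / 3) (by linarith))
    have e3 := (hact.const_mul (1 / 2)).eventually (lt_mem_nhds (sub_lt_self _
      (by positivity : 0 < δ / 3)))
    obtain ⟨n, ⟨hn1, hn2⟩, hn3⟩ := ((e1.and e2).and e3).exists
    linarith
  have heq : EqOn x xstar.1 (Icc 0 T) := huniq ⟨x, hx⟩ (le_antisymm (hmax ⟨x, hx⟩) hge)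
  filter_upwards [Metric.tendstoUniformlyOn_iff.1
    (tendstoUniformlyOn_interp hT h0 hNl hx hpx) ε hε] with n hn t ht
  rw [← heq ht]
  exact hn t ht

end Convergence

end LeastAction

end

theorem theorem1 (m s : ℕ) (T : ℝ) (hT : 0 < T)
    (ν K : ℕ) (hTK : T * 2 ^ ν = K)
    (σ : ℝ → LeastAction.State m s → (LeastAction.State m s →L[ℝ] LeastAction.State m s))
    (μ : ℝ → LeastAction.State m s → LeastAction.State m s)
    (φ : EuclideanSpace ℝ (Fin m) → ℝ)
    (y : ℝ → EuclideanSpace ℝ (Fin s))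
    (hσinv : ∀ t ∈ Icc 0 T, ∀ z, (σ t z).IsInvertible)
    (hσ : LeastAction.IsC1b T σ)
    (hσ' : LeastAction.IsC1b T (fun t z => (σ t z).inverse))
    (hμ : LeastAction.IsC1b T μ)
    (hy : ContDiffOn ℝ 1 y (Icc 0 T))
    (hφ : Tendsto φ (cocompact (EuclideanSpace ℝ (Fin m))) atTop) :
    Tendsto
        (fun n : ℕ => ⨅ x : LeastAction.DiscretePath m T n,
          ((-LeastAction.discreteLogLik T σ μ φ y n x : ℝ) : EReal))
        atTop
        (𝓝 (⨅ x : LeastAction.C1Path m T,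
          ((-LeastAction.contLogLik T σ μ φ y x.1 : ℝ) : EReal))) ∧
      (LowerSemicontinuous φ →
        ∀ xstar : LeastAction.C1Path m T,
          (∀ x : LeastAction.C1Path m T,
            LeastAction.contLogLik T σ μ φ y x.1 ≤ LeastAction.contLogLik T σ μ φ y xstar.1) →
          (∀ x : LeastAction.C1Path m T,
            LeastAction.contLogLik T σ μ φ y x.1 = LeastAction.contLogLik T σ μ φ y xstar.1 →
              EqOn x.1 xstar.1 (Icc 0 T)) →
          ∀ xmax : (n : ℕ) → LeastAction.DiscretePath m T n,
            (∀ n, ν ≤ n → ∀ x : LeastAction.DiscretePath m T n,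
              LeastAction.discreteLogLik T σ μ φ y n x
                ≤ LeastAction.discreteLogLik T σ μ φ y n (xmax n)) →
            TendstoUniformlyOn (fun n t => LeastAction.DiscretePath.interp (xmax n) t)
              xstar.1 atTop (Icc 0 T)) := by
  have hN : ∀ᶠ n in atTop, LeastAction.numSteps T n * LeastAction.meshSize n = T :=
    (eventually_ge_atTop ν).mono fun n hn => LeastAction.numSteps_mul_meshSize hTK hn
  obtain ⟨C, hL, hyC⟩ := LeastAction.exists_regular_residual hT hσinv hσ hσ' hμ hy
  refine ⟨LeastAction.tendsto_iInf_discrete hT hL hy hyC hN hφ,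
    fun hφl xstar hmax huniq xmax hxmax => ?_⟩
  exact LeastAction.tendstoUniformlyOn_interp_of_maximizers hT hL hy hyC hN hφ hφl xstar hmax
    huniq xmax ((eventually_ge_atTop ν).mono hxmax)
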